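/- For $a,b,c\in\mathbb{C}$ let $C_{abc}\subset\mathbb{P}^2_{\mathbb{C}}$ be the plane projective curve (closed subscheme) with equation $$x^4+y^4+z^4+2a\,x^2y^2+2b\,x^2z^2+2c\,y^2z^2=0 .$$ a) $C_{abc}$ is singular (that is, not smooth over $\mathbb{C}$) if and only if $a=\pm1$ or $b=\pm1$ or $c=\pm1$ or $a^2+b^2+c^2-2abc-1=0$. b) Let $V\subset\mathbb{A}^3_{\mathbb{C}}$ be the zero set of the polynomial $(a^2-1)(b^2-1)(c^2-1)(a^2+b^2+c^2-2abc-1)$, let $U=\mathbb{A}^3_{\mathbb{C}}\setminus V$, and let $$\mathcal{C}=\{((x:y:z),(a,b,c))\in\mathbb{P}^2\times U:\ (x:y:z)\in C_{abc}\}$$ be the closed subscheme of $\mathbb{P}^2_{\mathbb{C}}\times U$ defined by the equation above with $a,b,c$ the coordinate functions on $U$; its fibre over a point $(a,b,c)\in U$ is $C_{abc}$ (and likewise over all of $\mathbb{A}^3_{\mathbb{C}}$ for the subscheme of $\mathbb{P}^2_{\mathbb{C}}\times\mathbb{A}^3_{\mathbb{C}}$ with this equation). Then the projection $\mathcal{C}\to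 U$ is a family of nonsingular projective curves of genus $3$: it is a projective morphism, smooth of relative dimension $1$, its fibres are geometrically integral, and every fibre $\mathcal{C}_u$ has genus $\dim_{\kappa(u)}H^0(\mathcal{C}_u,\Omega_{\mathcal{C}_u/\kappa(u)})=3$. -/

import Mathlib

open AlgebraicGeometry CategoryTheory CategoryTheory.Limits
open scoped KaehlerDifferential DirectSum

noncomputable section

attribute [local instance] MvPolynomial.gradedAlgebra

/-! ### Quotients of graded algebras by homogeneous ideals -/

section QuotientGrading

/-- The grading on `A ⧸ I` whose degree `n` part is the image of `𝒜 n`. -/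
def quotientGrading {R A : Type*} [CommRing R] [CommRing A] [Algebra R A]
    (𝒜 : ℕ → Submodule R A) (I : Ideal A) (n : ℕ) : Submodule R (A ⧸ I) :=
  (𝒜 n).map (Ideal.Quotient.mkₐ R I).toLinearMap

variable {R A : Type*} [CommRing R] [CommRing A] [Algebra R A]
  (𝒜 : ℕ → Submodule R A) [GradedAlgebra 𝒜] (I : Ideal A)

instance quotientGrading_gradedMonoid : SetLike.GradedMonoid (quotientGrading 𝒜 I) where
  one_mem := ⟨1, SetLike.GradedOne.one_mem, map_one (Ideal.Quotient.mkₐ R I)⟩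
  mul_mem := by
    rintro i j _ _ ⟨x, hx, rfl⟩ ⟨y, hy, rfl⟩
    exact ⟨x * y, SetLike.GradedMul.mul_mem hx hy, map_mul (Ideal.Quotient.mkₐ R I) x y⟩

/-- The quotient map in degree `n`. -/
def quotientGradingMk (n : ℕ) : 𝒜 n →ₗ[R] quotientGrading 𝒜 I n :=
  (Ideal.Quotient.mkₐ R I).toLinearMap.restrict fun x hx => ⟨x, hx, rfl⟩

/-- The map `A → ⨁ₙ (A ⧸ I)ₙ` sending an element to the classes of its components. -/
def quotientGradingDecomposeAux : A →ₐ[R] ⨁ n, quotientGrading 𝒜 I n :=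
  (DirectSum.toAlgebra R (fun n => 𝒜 n)
    (fun n => (DirectSum.lof R ℕ (fun n => quotientGrading 𝒜 I n) n).comp
      (quotientGradingMk 𝒜 I n))
    rfl
    (fun {i j} x y => by
      simp only [LinearMap.comp_apply, DirectSum.lof_eq_of]
      rw [DirectSum.of_mul_of]
      rfl)).comp
    (DirectSum.decomposeAlgEquiv 𝒜).toAlgHom

theorem quotientGradingDecomposeAux_of_mem {n : ℕ} (x : 𝒜 n) :
    quotientGradingDecomposeAux 𝒜 I (x : A) =
      DirectSum.of (fun n => quotientGrading 𝒜 I n) n (quotientGradingMk 𝒜 I n x) := by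
  have h : quotientGradingDecomposeAux 𝒜 I (x : A) =
      DirectSum.toAddMonoid (fun n => ((DirectSum.lof R ℕ (fun n => quotientGrading 𝒜 I n) n).comp
        (quotientGradingMk 𝒜 I n)).toAddMonoidHom) (DirectSum.decompose 𝒜 (x : A)) := rfl
  rw [h, DirectSum.decompose_coe]
  exact DirectSum.toAddMonoid_of (β := fun n => 𝒜 n) _ n x

theorem quotientGradingDecomposeAux_apply (a : A) (n : ℕ) :
    ((quotientGradingDecomposeAux 𝒜 I a n : quotientGrading 𝒜 I n) : A ⧸ I) =
      Ideal.Quotient.mk I (DirectSum.decompose 𝒜 a n : A) := by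
  induction a using DirectSum.Decomposition.inductionOn 𝒜 with
  | zero => simp
  | @homogeneous i x =>
    rw [quotientGradingDecomposeAux_of_mem, DirectSum.decompose_coe]
    by_cases h : i = n
    · subst h
      simp only [DirectSum.of_eq_same]
      rfl
    · rw [DirectSum.of_eq_of_ne _ _ _ (Ne.symm h), DirectSum.of_eq_of_ne _ _ _ (Ne.symm h)]
      simp
  | add a b ha hb => simp [ha, hb]

/-- The quotient of a graded algebra by a homogeneous ideal is graded. -/
abbrev quotientGradedAlgebra (hI : I.IsHomogeneous 𝒜) :
    GradedAlgebra (quotientGrading 𝒜 I) :=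
  GradedAlgebra.ofAlgHom _
    (Ideal.Quotient.liftₐ I (quotientGradingDecomposeAux 𝒜 I) (fun a ha => by
      refine DFinsupp.ext fun n => Subtype.ext ?_
      refine (quotientGradingDecomposeAux_apply 𝒜 I a n).trans ?_
      exact Ideal.Quotient.eq_zero_iff_mem.mpr (hI n ha)))
    (by
      refine Ideal.Quotient.algHom_ext _ (AlgHom.ext fun a => ?_)
      induction a using DirectSum.Decomposition.inductionOn 𝒜 with
      | zero => simp
      | @homogeneous i x =>
        simp only [AlgHom.comp_apply, Ideal.Quotient.mkₐ_eq_mk, Ideal.Quotient.liftₐ_apply]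
        erw [quotientGradingDecomposeAux_of_mem, DirectSum.coeAlgHom_of]
        rfl
      | add a b ha hb => rw [map_add, ha, hb, map_add])
    (by
      rintro i ⟨_, x, hx, rfl⟩
      exact quotientGradingDecomposeAux_of_mem 𝒜 I (⟨x, hx⟩ : 𝒜 i))

end QuotientGrading

/-! ### The plane quartics -/

/-- The form `x⁴ + y⁴ + z⁴ + 2a x²y² + 2b x²z² + 2c y²z²`, where `x, y, z = X 0, X 1, X 2`. -/
def quarticForm {R : Type*} [CommRing R] (a b c : R) : MvPolynomial (Fin 3) R :=
  .X 0 ^ 4 + .X 1 ^ 4 + .X 2 ^ 4 + 2 * .C a * .X 0 ^ 2 * .X 1 ^ 2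
    + 2 * .C b * .X 0 ^ 2 * .X 2 ^ 2 + 2 * .C c * .X 1 ^ 2 * .X 2 ^ 2

theorem quarticForm_isHomogeneous {R : Type*} [CommRing R] (a b c : R) :
    (quarticForm a b c).IsHomogeneous 4 := by
  have hX (i : Fin 3) (n : ℕ) : (MvPolynomial.X i ^ n : MvPolynomial (Fin 3) R).IsHomogeneous n :=
    by simpa using (MvPolynomial.isHomogeneous_X R i).pow n
  have hC (r : R) : (2 * MvPolynomial.C r : MvPolynomial (Fin 3) R).IsHomogeneous 0 := by
    have := MvPolynomial.isHomogeneous_C (Fin 3) (2 * r)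
    rwa [map_mul, map_ofNat] at this
  have hM (r : R) (i j : Fin 3) : (2 * MvPolynomial.C r * .X i ^ 2 * .X j ^ 2 :
      MvPolynomial (Fin 3) R).IsHomogeneous 4 := by
    simpa using ((hC r).mul (hX i 2)).mul (hX j 2)
  exact (((((hX 0 4).add (hX 1 4)).add (hX 2 4)).add (hM a 0 1)).add (hM b 0 2)).add (hM c 1 2)

/-- The grading of the homogeneous coordinate ring `R[x, y, z] ⧸ (F)` by degree. -/
abbrev quarticGrading {R : Type*} [CommRing R] (a b c : R) :
    ℕ → Submodule R (MvPolynomial (Fin 3) R ⧸ Ideal.span {quarticForm a b c}) :=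
  quotientGrading (MvPolynomial.homogeneousSubmodule (Fin 3) R) (Ideal.span {quarticForm a b c})

instance quarticGrading_gradedAlgebra {R : Type*} [CommRing R] (a b c : R) :
    GradedAlgebra (quarticGrading a b c) :=
  quotientGradedAlgebra _ _ (Ideal.homogeneous_span _ _ (by
    rintro _ rfl
    exact ⟨4, quarticForm_isHomogeneous a b c⟩))

universe u

/-- The closed subscheme `x⁴ + y⁴ + z⁴ + 2a x²y² + 2b x²z² + 2c y²z² = 0` of the projective plane
over `R`, as the `Proj` of its homogeneous coordinate ring. -/
def planeQuartic {R : Type u} [CommRing R] (a b c : R) : Scheme.{u} :=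
  Proj (quarticGrading a b c)

/-- The structure morphism of `planeQuartic a b c` to the base `Spec R`. -/
def planeQuarticToSpec {R : Type u} [CommRing R] (a b c : R) :
    planeQuartic a b c ⟶ Spec (.of R) :=
  Proj.toSpecZero (quarticGrading a b c) ≫
    Spec.map (CommRingCat.ofHom (algebraMap R (quarticGrading a b c 0)))

/-- The polynomial `(a² - 1)(b² - 1)(c² - 1)(a² + b² + c² - 2abc - 1)`,
where `a, b, c = X 0, X 1, X 2`. -/
def discriminantPoly : MvPolynomial (Fin 3) ℂ :=
  (.X 0 ^ 2 - 1) * (.X 1 ^ 2 - 1) * (.X 2 ^ 2 - 1) *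
    (.X 0 ^ 2 + .X 1 ^ 2 + .X 2 ^ 2 - 2 * .X 0 * .X 1 * .X 2 - 1)

/-- The complement in affine 3-space over `ℂ` of the zero set of `discriminantPoly`. -/
def parameterOpen : (Spec (.of (MvPolynomial (Fin 3) ℂ))).Opens :=
  PrimeSpectrum.basicOpen discriminantPoly

/-- The family of all the quartics over affine 3-space: the quartic whose coefficients
are the coordinate functions. -/
def totalFamily : planeQuartic (.X 0 : MvPolynomial (Fin 3) ℂ) (.X 1) (.X 2) ⟶
    Spec (.of (MvPolynomial (Fin 3) ℂ)) :=
  planeQuarticToSpec (R := MvPolynomial (Fin 3) ℂ) (.X 0) (.X 1) (.X 2)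

/-- The part `𝒞` of the total family that lies over `parameterOpen`. -/
def curveFamily : (totalFamily ⁻¹ᵁ parameterOpen).toScheme ⟶ parameterOpen.toScheme :=
  totalFamily ∣_ parameterOpen

/-! ### The genus -/

section Genus

variable {k : CommRingCat.{u}} {X : Scheme.{u}}

/-- The ring `Γ(X, U)`, to be regarded as a `k`-algebra by means of `f : X ⟶ Spec k`. -/
def SectionRing (_f : X ⟶ Spec k) (U : X.Opens) : Type u := Γ(X, U)

instance (f : X ⟶ Spec k) (U : X.Opens) : CommRing (SectionRing f U) :=
  inferInstanceAs (CommRing Γ(X, U))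

instance (f : X ⟶ Spec k) (U : X.Opens) : Algebra k (SectionRing f U) :=
  ((Scheme.ΓSpecIso k).inv ≫ f.appLE ⊤ U le_top).hom.toAlgebra

/-- Restriction of sections, as a homomorphism of `k`-algebras. -/
def SectionRing.res (f : X ⟶ Spec k) {U V : X.Opens} (h : V ≤ U) :
    SectionRing f U →ₐ[k] SectionRing f V where
  __ := (X.presheaf.map (homOfLE h).op).hom
  commutes' r := by
    have := congr($(f.appLE_map (U := ⊤) (V := U) le_top (homOfLE h).op).hom
      ((Scheme.ΓSpecIso k).inv.hom r))
    exact this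

/-- The map `Ω[A⁄k] → Ω[B⁄k]`, `s dt ↦ φ(s) dφ(t)`, induced by a `k`-algebra homomorphism. -/
def kaehlerMap {k A B : Type*} [CommRing k] [CommRing A] [CommRing B] [Algebra k A] [Algebra k B]
    (φ : A →ₐ[k] B) : Ω[A⁄k] →ₗ[k] Ω[B⁄k] :=
  letI := φ.toRingHom.toAlgebra
  haveI : IsScalarTower k A B := .of_algebraMap_eq fun r => (φ.commutes r).symm
  (KaehlerDifferential.map k k A B).restrictScalars k

/-- The `k`-module `H⁰(X, Ω_{X/k})` of global differential forms: a form is a family of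
elements `ω U` of `Ω[Γ(X, U)⁄k]`, for all affine open `U`, compatible with restriction. -/
def globalDifferentials (f : X ⟶ Spec k) :
    Submodule k (∀ U : X.affineOpens, Ω[SectionRing f U.1⁄k]) where
  carrier := {ω | ∀ (U V : X.affineOpens) (h : V.1 ≤ U.1),
    kaehlerMap (SectionRing.res f h) (ω U) = ω V}
  zero_mem' U V h := map_zero _
  add_mem' hx hy U V h := by simp only [Pi.add_apply, map_add, hx U V h, hy U V h]
  smul_mem' r x hx U V h := by simp only [Pi.smul_apply, map_smul, hx U V h]

/-- The genus `dim H⁰(X, Ω_{X/k})` of a smooth projective curve `X` over a field `k`. -/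
def curveGenus (f : X ⟶ Spec k) : ℕ := Module.finrank k (globalDifferentials f)

end Genus

/-! ### Families of curves -/

/-- Projective `n`-space over a scheme `S`. -/
def projectiveSpace (n : ℕ) (S : Scheme.{0}) : Scheme.{0} :=
  pullback (terminal.from S)
    (terminal.from (Proj (MvPolynomial.homogeneousSubmodule (Fin (n + 1)) ℤ)))

/-- The projection of projective `n`-space over `S` to `S`. -/
def projectiveSpaceToBase (n : ℕ) (S : Scheme.{0}) : projectiveSpace n S ⟶ S :=
  pullback.fst _ _

/-- A morphism `X ⟶ S` is projective if it factors as a closed immersion into some projective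
space over `S` followed by the projection. -/
def IsProjectiveMorphism {X S : Scheme.{0}} (f : X ⟶ S) : Prop :=
  ∃ (n : ℕ) (i : X ⟶ projectiveSpace n S), IsClosedImmersion i ∧ i ≫ projectiveSpaceToBase n S = f

/-- `f : X ⟶ S` is a family of nonsingular projective curves of genus `g`: it is smooth of relative
dimension one and projective, and its fibres are geometrically integral of genus `g`. -/
structure IsSmoothProjectiveCurveFamily {X S : Scheme.{0}} (f : X ⟶ S) (g : ℕ) : Prop where
  smooth : SmoothOfRelativeDimension 1 f
  projective : IsProjectiveMorphism f
  integral : GeometricallyIntegral f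
  genus : ∀ s : S, curveGenus (f.fiberToSpecResidueField s) = g

end

/-! Let `M` be the symmetric matrix with ones on the diagonal and `a, b, c` off it. The quartic is
the quadratic form of `M` in `x², y², z²`, so its partials are `4x ℓ₁`, `4y ℓ₂`, `4z ℓ₃`, where the
`ℓᵢ` are the entries of `M (x², y², z²)ᵗ`. At a singular point with no zero coordinate `det M = 0`.
If one coordinate vanishes, a principal minor `1 - a²`, `1 - b²` or `1 - c²` does. Two cannot
vanish, because the diagonal entries are 1. Conversely, over an algebraically closed field, square
roots of a kernel vector of `M`, or of a principal 2×2 block, give a singular point.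

The point `(0 : 0 : 1)` is never on the curve, so the charts `x ≠ 0` and `y ≠ 0` suffice, and
exchanging `b` and `c` turns one into the other. Smoothness is proved over any base ring in which 2
and the discriminant factors are units: there the partials generate the unit ideal
(`span_chartDu_chartDv_eq_top`), and where one of them is invertible the chart is étale over a line.
Formal smoothness in turn forces the partials to generate the unit ideal
(`span_chartDu_chartDv_eq_top_of_formallySmooth`), which fails at a singular point.

For integrality each chart is given by a monic biquadratic polynomial in `v` over `K[u]`,
irreducible over every field with `2 ≠ 0` (`irreducible_biquadratic`); that no field is excluded but
those makes the fibres geometrically integral. The formation of the quartic commutes with change of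
coefficients (`isPullback_quarticMap`), so statements about the family reduce to quartics over rings
and fields.

For the genus, `η = du / F_v = -dv / F_u` (up to a constant) generates the differentials of a chart.
On the overlap the two generators differ by the factor `-u` (`kaehlerMap_chartForm`), which is the
adjunction formula `Ω = O(1)`. A form regular on both charts is therefore `(r + su + tv) η` with
constants `r, s, t` (`exists_eq_linear_combination`), and these form a space of dimension 3.
`finrank_globalDifferentials` identifies the global differentials with the forms over the function
field that are regular on both charts. -/

noncomputable section

attribute [local instance] MvPolynomial.gradedAlgebra

universe u

/-! ### The affine charts -/

section ChartRing

variable {R T : Type*} [CommRing R] [CommRing T]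

/-- The dehomogenization `v⁴ + 2(b + cu²)v² + (1 + 2au² + u⁴)` of the quartic form at `x = 1`,
with `u = y` and `v = z`, as a polynomial in `v` over `R[u]`. -/
def chartPoly (a b c : R) : Polynomial (Polynomial R) :=
  .X ^ 4 + .C (.C (2 * b) + .C (2 * c) * .X ^ 2) * .X ^ 2 + .C (1 + .C (2 * a) * .X ^ 2 + .X ^ 4)

theorem chartPoly_eq_add (a b c : R) : chartPoly a b c = .X ^ 4 +
    (.C (.C (2 * b) + .C (2 * c) * .X ^ 2) * .X ^ 2 + .C (1 + .C (2 * a) * .X ^ 2 + .X ^ 4)) := by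
  rw [chartPoly, add_assoc]

theorem chartPoly_tail_degree_lt (p q : Polynomial R) :
    (Polynomial.C p * .X ^ 2 + .C q : Polynomial (Polynomial R)).degree < (4 : ℕ) := by
  refine (Polynomial.degree_add_le _ _).trans_lt (max_lt ?_ ?_)
  · exact (Polynomial.degree_C_mul_X_pow_le _ _).trans_lt (by norm_num)
  · exact Polynomial.degree_C_le.trans_lt (by norm_num)

theorem chartPoly_monic (a b c : R) : (chartPoly a b c).Monic := by
  rw [chartPoly_eq_add]
  exact Polynomial.monic_X_pow_add (chartPoly_tail_degree_lt _ _)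

theorem chartPoly_natDegree [Nontrivial R] (a b c : R) : (chartPoly a b c).natDegree = 4 := by
  rw [chartPoly_eq_add, Polynomial.natDegree_add_eq_left_of_degree_lt, Polynomial.natDegree_X_pow]
  rw [Polynomial.degree_X_pow]
  exact chartPoly_tail_degree_lt _ _

/-- The coordinate ring `R[u, v] ⧸ (1 + u⁴ + v⁴ + 2au² + 2bv² + 2cu²v²)`. -/
abbrev ChartRing (a b c : R) : Type _ := AdjoinRoot (chartPoly a b c)

/-- The coordinate `u`. -/
def chartU (a b c : R) : ChartRing a b c := AdjoinRoot.of _ .X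

/-- The coordinate `v`. -/
def chartV (a b c : R) : ChartRing a b c := AdjoinRoot.root _

/-- The affine equation, evaluated in an algebra. -/
def affineQuartic (a b c u v : T) : T :=
  1 + u ^ 4 + v ^ 4 + 2 * a * u ^ 2 + 2 * b * v ^ 2 + 2 * c * u ^ 2 * v ^ 2

theorem eval₂_chartPoly (φ : R →+* T) (a b c : R) (u v : T) :
    (chartPoly a b c).eval₂ (Polynomial.eval₂RingHom φ u) v =
      affineQuartic (φ a) (φ b) (φ c) u v := by
  have h2 : φ 2 = 2 := map_ofNat φ 2
  simp only [chartPoly, affineQuartic]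
  simp [-map_pow, h2]
  ring

theorem algebraMap_chartRing (a b c r : R) :
    algebraMap R (ChartRing a b c) r = AdjoinRoot.of _ (.C r) := rfl

theorem chartRing_relation (a b c : R) :
    affineQuartic (algebraMap R (ChartRing a b c) a) (algebraMap R (ChartRing a b c) b)
      (algebraMap R (ChartRing a b c) c) (chartU a b c) (chartV a b c) = 0 := by
  rw [← eval₂_chartPoly]
  have : Polynomial.eval₂RingHom (algebraMap R (ChartRing a b c)) (chartU a b c) =
      AdjoinRoot.of (chartPoly a b c) := by
    refine Polynomial.ringHom_ext (fun r => ?_) ?_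
    · simp [algebraMap_chartRing]
    · simp [chartU]
  rw [this]
  exact AdjoinRoot.eval₂_root _

/-- The ring homomorphism out of the chart ring given by a solution of the affine equation. -/
def chartLift {a b c : R} (φ : R →+* T) (u v : T)
    (h : affineQuartic (φ a) (φ b) (φ c) u v = 0) : ChartRing a b c →+* T :=
  AdjoinRoot.lift (Polynomial.eval₂RingHom φ u) v (by rw [eval₂_chartPoly, h])

section

variable {a b c : R} (φ : R →+* T) (u v : T) (h : affineQuartic (φ a) (φ b) (φ c) u v = 0)

@[simp]
theorem chartLift_algebraMap (r : R) : chartLift φ u v h (algebraMap R _ r) = φ r := by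
  simp [chartLift, algebraMap_chartRing]

@[simp]
theorem chartLift_chartU : chartLift φ u v h (chartU a b c) = u := by
  simp [chartLift, chartU]

@[simp]
theorem chartLift_chartV : chartLift φ u v h (chartV a b c) = v := by
  simp [chartLift, chartV]

end

theorem chartRing_hom_ext {a b c : R} {f g : ChartRing a b c →+* T}
    (h : ∀ r, f (algebraMap R _ r) = g (algebraMap R _ r))
    (hu : f (chartU a b c) = g (chartU a b c)) (hv : f (chartV a b c) = g (chartV a b c)) :
    f = g :=
  AdjoinRoot.ringHom_ext (Polynomial.ringHom_ext h hu) hv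

/-- The isomorphism that exchanges the coordinates. -/
def chartSwap (a b c : R) : ChartRing a b c ≃ₐ[R] ChartRing b a c :=
  AlgEquiv.ofRingEquiv (f := RingEquiv.ofRingHom
    (chartLift (algebraMap R _) (chartV b a c) (chartU b a c) (by
      rw [← chartRing_relation b a c]; simp only [affineQuartic]; ring))
    (chartLift (algebraMap R _) (chartV a b c) (chartU a b c) (by
      rw [← chartRing_relation a b c]; simp only [affineQuartic]; ring))
    (chartRing_hom_ext (by simp) (by simp) (by simp))
    (chartRing_hom_ext (by simp) (by simp) (by simp))) (by simp)

@[simp]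
theorem chartSwap_chartU (a b c : R) : chartSwap a b c (chartU a b c) = chartV b a c := by
  simp [chartSwap]

@[simp]
theorem chartSwap_chartV (a b c : R) : chartSwap a b c (chartV a b c) = chartU b a c := by
  simp [chartSwap]

/-- The derivative of the affine equation with respect to `u`, divided by four. -/
def chartDu (a b c : R) : ChartRing a b c :=
  chartU a b c * (chartU a b c ^ 2 + algebraMap R _ a + algebraMap R _ c * chartV a b c ^ 2)

/-- The derivative of the affine equation with respect to `v`, divided by four. -/
def chartDv (a b c : R) : ChartRing a b c :=
  chartV a b c * (chartV a b c ^ 2 + algebraMap R _ b + algebraMap R _ c * chartU a b c ^ 2)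

@[simp]
theorem chartSwap_chartDv (a b c : R) : chartSwap a b c (chartDv a b c) = chartDu b a c := by
  simp [chartDv, chartDu]

/-- The determinant of the symmetric matrix with off-diagonal entries `a, b, c`, up to sign. -/
def symmDet (a b c : R) : R := a ^ 2 + b ^ 2 + c ^ 2 - 2 * a * b * c - 1

theorem span_chartDu_chartDv_eq_top {a b c : R} (ha : IsUnit (a ^ 2 - 1)) (hb : IsUnit (b ^ 2 - 1))
    (hd : IsUnit (symmDet a b c)) :
    Ideal.span {chartDu a b c, chartDv a b c} = ⊤ := by
  set J := Ideal.span {chartDu a b c, chartDv a b c}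
  set A := algebraMap R (ChartRing a b c) a with hA
  set B := algebraMap R (ChartRing a b c) b with hB
  set C := algebraMap R (ChartRing a b c) c with hC
  set u := chartU a b c
  set v := chartV a b c
  have mem_of_unit {r : R} (hr : IsUnit r) {x : ChartRing a b c}
      (h : x * algebraMap R _ r ∈ J) : x ∈ J := by
    rwa [Ideal.mul_unit_mem_iff_mem _ (hr.map _)] at h
  have h1 : u * (u ^ 2 + A + C * v ^ 2) ∈ J := Ideal.subset_span (Or.inl rfl)
  have h2 : v * (v ^ 2 + B + C * u ^ 2) ∈ J := Ideal.subset_span (Or.inr rfl)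
  -- Euler's relation: the third partial lies in `J` because the equation and the other two do.
  have h0 : 1 + A * u ^ 2 + B * v ^ 2 ∈ J := by
    have hrel := chartRing_relation a b c
    have : 1 + A * u ^ 2 + B * v ^ 2 = affineQuartic A B C u v -
        (u * (u * (u ^ 2 + A + C * v ^ 2)) + v * (v * (v ^ 2 + B + C * u ^ 2))) := by
      simp only [affineQuartic]; ring
    rw [this, hrel, zero_sub]
    exact neg_mem (add_mem (J.mul_mem_left _ h1) (J.mul_mem_left _ h2))
  have huv : u * v ∈ J := by
    refine mem_of_unit hd ?_
    -- The multipliers are, up to sign, the first row of the adjugate of the symmetric matrix. The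
    -- factor `u * v` is needed because only `u` and `v` times the last two linear forms lie in `J`.
    have : u * v * algebraMap R _ (symmDet a b c) =
        (C ^ 2 - 1) * u * v * (1 + A * u ^ 2 + B * v ^ 2) +
        (A - B * C) * v * (u * (u ^ 2 + A + C * v ^ 2)) +
        (B - A * C) * u * (v * (v ^ 2 + B + C * u ^ 2)) := by
      simp only [symmDet, map_sub, map_add, map_mul, map_pow, map_one, map_ofNat, ← hA, ← hB, ← hC]
      ring
    rw [this]
    exact add_mem (add_mem (J.mul_mem_left _ h0) (J.mul_mem_left _ h1)) (J.mul_mem_left _ h2)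
  have hu : u ∈ J := by
    refine mem_of_unit ha ?_
    -- Modulo `u * v` only the 2×2 block with off-diagonal entry `a` remains, and `a ^ 2 - 1` is its
    -- determinant up to sign.
    have : u * algebraMap R _ (a ^ 2 - 1) = A * (u * (u ^ 2 + A + C * v ^ 2)) -
        u * (1 + A * u ^ 2 + B * v ^ 2) + (B * v - A * C * v) * (u * v) := by
      simp only [map_sub, map_pow, map_one, ← hA]
      ring
    rw [this]
    exact add_mem (sub_mem (J.mul_mem_left _ h1) (J.mul_mem_left _ h0)) (J.mul_mem_left _ huv)
  have hv : v ∈ J := by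
    refine mem_of_unit hb ?_
    have : v * algebraMap R _ (b ^ 2 - 1) = B * (v * (v ^ 2 + B + C * u ^ 2)) -
        v * (1 + A * u ^ 2 + B * v ^ 2) + (A * u - B * C * u) * (u * v) := by
      simp only [map_sub, map_pow, map_one, ← hB]
      ring
    rw [this]
    exact add_mem (sub_mem (J.mul_mem_left _ h2) (J.mul_mem_left _ h0)) (J.mul_mem_left _ huv)
  rw [Ideal.eq_top_iff_one]
  have : (1 : ChartRing a b c) =
      1 + A * u ^ 2 + B * v ^ 2 - (A * u) * u - (B * v) * v := by ring
  rw [this]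
  exact sub_mem (sub_mem h0 (J.mul_mem_left _ hu)) (J.mul_mem_left _ hv)

end ChartRing

/-! ### Smoothness of the charts -/

section ChartSmooth

variable {R : Type*} [CommRing R]

theorem aeval_derivative_chartPoly (a b c : R) :
    AdjoinRoot.mk (chartPoly a b c) (chartPoly a b c).derivative = 4 * chartDv a b c := by
  have h : (chartPoly a b c).derivative =
      4 * (.X * (.X ^ 2 + .C (.C b) + .C (.C c * .X ^ 2))) := by
    have (p q : Polynomial R) :
        (.X ^ 4 + .C p * .X ^ 2 + .C q : Polynomial (Polynomial R)).derivative
        = 4 * .X ^ 3 + .C p * (2 * .X) := by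
      simp only [Polynomial.derivative_add, Polynomial.derivative_C_mul,
        Polynomial.derivative_X_pow, Polynomial.derivative_C]
      norm_num [Polynomial.C_ofNat]
    rw [chartPoly, this]
    simp only [map_add, map_mul, map_ofNat]
    ring
  rw [h, map_mul, map_ofNat]
  simp [chartDv, chartV, chartU, algebraMap_chartRing]

/-- The differentials are free of rank one on `dX`, and a basis of exact differentials is what the
criterion for standard smoothness asks for. -/
instance isStandardSmoothOfRelativeDimension_polynomial [Nontrivial R] :
    Algebra.IsStandardSmoothOfRelativeDimension 1 R (Polynomial R) := by
  have : Algebra.IsStandardSmooth R (Polynomial R) :=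
    .of_basis_kaehlerDifferential
      ((Module.Basis.singleton Unit (Polynomial R)).map
        (KaehlerDifferential.polynomialEquiv R).symm)
      (by
        rintro _ ⟨i, rfl⟩
        exact ⟨.X, by simp⟩)
  rw [Algebra.IsStandardSmoothOfRelativeDimension.iff_of_isStandardSmooth,
    (KaehlerDifferential.polynomialEquiv R).rank_eq, Module.rank_self, Nat.cast_one]

/-- The chart is standard étale over the `u`-line where the `v`-derivative does not vanish. -/
def chartStandardEtalePair (a b c : R) : StandardEtalePair (Polynomial R) where
  f := chartPoly a b c
  monic_f := chartPoly_monic a b c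
  g := (chartPoly a b c).derivative
  -- Some combination of `f'` and `f` must be a power of `g`; as `g = f'`, this is `f' * 1 + f * 0 =
  -- g ^ 1`.
  cond := ⟨1, 0, 1, by simp⟩

/-- Étale over the `u`-line, of relative dimension zero, followed by the line over `R`, of relative
dimension one. -/
theorem isStandardSmoothOfRelativeDimension_away_mk_derivative [Nontrivial R] (a b c : R) :
    Algebra.IsStandardSmoothOfRelativeDimension 1 R (Localization.Away
      (AdjoinRoot.mk (chartPoly a b c) (chartPoly a b c).derivative)) := by
  have : Algebra.Etale (Polynomial R) (Localization.Away
      (AdjoinRoot.mk (chartPoly a b c) (chartPoly a b c).derivative)) :=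
    .of_equiv (chartStandardEtalePair a b c).equivAwayAdjoinRoot
  have := Algebra.Etale.iff_isStandardSmoothOfRelativeDimension_zero.mp this
  exact .trans 1 0 R (Polynomial R) _

theorem isStandardSmoothOfRelativeDimension_away_chartDv [Nontrivial R] (h2 : IsUnit (2 : R))
    (a b c : R) :
    Algebra.IsStandardSmoothOfRelativeDimension 1 R (Localization.Away (chartDv a b c)) := by
  have h := isStandardSmoothOfRelativeDimension_away_mk_derivative a b c
  rw [aeval_derivative_chartPoly] at h
  have h4 : IsUnit (4 : ChartRing a b c) := by
    have := (h2.mul h2).map (algebraMap R (ChartRing a b c))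
    rw [map_mul, map_ofNat] at this
    norm_num at this
    exact this
  have : IsLocalization.Away (chartDv a b c) (Localization.Away (4 * chartDv a b c)) :=
    IsLocalization.Away.of_associated ((associated_isUnit_mul_left_iff h4).mpr (Associated.refl _))
  exact .of_algEquiv 1 ((IsLocalization.algEquiv (.powers (chartDv a b c))
    (Localization.Away (4 * chartDv a b c)) (Localization.Away (chartDv a b c))).restrictScalars R)

theorem isStandardSmoothOfRelativeDimension_away_chartDu [Nontrivial R] (h2 : IsUnit (2 : R))
    (a b c : R) :
    Algebra.IsStandardSmoothOfRelativeDimension 1 R (Localization.Away (chartDu a b c)) := by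
  have h := isStandardSmoothOfRelativeDimension_away_chartDv h2 b a c
  exact .of_algEquiv 1 (IsLocalization.algEquivOfAlgEquiv (Localization.Away (chartDv b a c))
    (Localization.Away (chartDu a b c)) (chartSwap b a c)
    ((Submonoid.map_powers (chartSwap b a c) _).trans (by rw [chartSwap_chartDv])))

/-- The loci where one of the two partials is invertible cover the chart, as the partials generate
the unit ideal. -/
theorem locally_isStandardSmoothOfRelativeDimension_chartRing {R : Type u} [CommRing R]
    [Nontrivial R]
    {a b c : R} (h2 : IsUnit (2 : R)) (ha : IsUnit (a ^ 2 - 1)) (hb : IsUnit (b ^ 2 - 1))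
    (hd : IsUnit (symmDet a b c)) :
    RingHom.Locally (RingHom.IsStandardSmoothOfRelativeDimension 1)
      (algebraMap R (ChartRing a b c)) := by
  refine ⟨_, span_chartDu_chartDv_eq_top ha hb hd, ?_⟩
  rintro t (rfl | rfl)
  · rw [← IsScalarTower.algebraMap_eq, RingHom.isStandardSmoothOfRelativeDimension_algebraMap]
    exact isStandardSmoothOfRelativeDimension_away_chartDu h2 a b c
  · rw [← IsScalarTower.algebraMap_eq, RingHom.isStandardSmoothOfRelativeDimension_algebraMap]
    exact isStandardSmoothOfRelativeDimension_away_chartDv h2 a b c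

end ChartSmooth

/-! ### Singular points of the charts -/

section ChartSingular

variable {R : Type*} [CommRing R]

theorem affineQuartic_C_X (a b c : R) :
    affineQuartic (.C (.C a)) (.C (.C b)) (.C (.C c)) (.C .X) .X = chartPoly a b c := by
  simp only [affineQuartic, chartPoly, map_add, map_mul, map_ofNat, map_pow, map_one]
  ring

/-- Taylor expansion to first order; the witness collects all terms of order at least two in `g`. -/
theorem affineQuartic_add_mul {T : Type*} [CommRing T] (a b c u v g s t : T) :
    g ^ 2 ∣ affineQuartic a b c (u + g * s) (v + g * t) - (affineQuartic a b c u v +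
      g * (4 * (u * (u ^ 2 + a + c * v ^ 2)) * s + 4 * (v * (v ^ 2 + b + c * u ^ 2)) * t)) :=
  ⟨s ^ 2 * (6 * u ^ 2 + 4 * u * (g * s) + (g * s) ^ 2) +
    t ^ 2 * (6 * v ^ 2 + 4 * v * (g * t) + (g * t) ^ 2) + 2 * a * s ^ 2 + 2 * b * t ^ 2 +
    2 * c * (u ^ 2 * t ^ 2 + 4 * u * v * s * t + 2 * u * s * (g * t ^ 2) + v ^ 2 * s ^ 2 +
      2 * v * t * (g * s ^ 2) + g ^ 2 * s ^ 2 * t ^ 2), by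
    simp only [affineQuartic]; ring⟩

theorem exists_section_of_formallySmooth {A Q : Type*} [CommRing A] [CommRing Q] [Algebra R A]
    [Algebra R Q] [Algebra.FormallySmooth R A] (π : Q →ₐ[R] A) (hπ : Function.Surjective π)
    (h : ∀ x y, π x = 0 → π y = 0 → x * y = 0) : ∃ σ : A →ₐ[R] Q, ∀ x, π (σ x) = x := by
  have hker : IsNilpotent (RingHom.ker (π : Q →+* A)) := by
    refine ⟨2, ?_⟩
    rw [pow_two, Ideal.zero_eq_bot, eq_bot_iff, Ideal.mul_le]
    exact fun x hx y hy => h x y hx hy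
  exact ⟨_, Algebra.FormallySmooth.liftOfSurjective_apply (AlgHom.id R A) π hπ hker⟩

/-- The map `R[u, v] / (g²) → R[u, v] / (g)` has square-zero kernel, so formal smoothness splits it.
The splitting moves `(u, v)` to `(u + g s, v + g t)`, and this point still solves the equation
modulo `g²`. -/
theorem span_chartDu_chartDv_eq_top_of_formallySmooth (a b c : R)
    [Algebra.FormallySmooth R (ChartRing a b c)] :
    Ideal.span {chartDu a b c, chartDv a b c} = ⊤ := by
  set g := chartPoly a b c with hg
  let π : (Polynomial (Polynomial R) ⧸ Ideal.span {g ^ 2}) →ₐ[R] ChartRing a b c :=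
    Ideal.Quotient.liftₐ _ (AdjoinRoot.mkₐ g |>.restrictScalars R) (fun x hx => by
      obtain ⟨y, rfl⟩ := Ideal.mem_span_singleton.mp hx
      simp [pow_two])
  have hπ (p) : π (Ideal.Quotient.mk _ p) = AdjoinRoot.mk g p := rfl
  have hsurj : Function.Surjective π := fun x => by
    obtain ⟨p, rfl⟩ := AdjoinRoot.mk_surjective x
    exact ⟨Ideal.Quotient.mk _ p, hπ p⟩
  have hmul (x y) (hx : π x = 0) (hy : π y = 0) : x * y = 0 := by
    obtain ⟨p, rfl⟩ := Ideal.Quotient.mk_surjective (I := Ideal.span {g ^ 2}) x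
    obtain ⟨q, rfl⟩ := Ideal.Quotient.mk_surjective (I := Ideal.span {g ^ 2}) y
    obtain ⟨p', rfl⟩ := AdjoinRoot.mk_eq_zero.mp ((hπ p).symm.trans hx)
    obtain ⟨q', rfl⟩ := AdjoinRoot.mk_eq_zero.mp ((hπ q).symm.trans hy)
    rw [← map_mul]
    exact Ideal.Quotient.eq_zero_iff_mem.mpr (Ideal.mem_span_singleton.mpr ⟨p' * q', by ring⟩)
  obtain ⟨σ, hσ⟩ := exists_section_of_formallySmooth
    (Q := Polynomial (Polynomial R) ⧸ Ideal.span {g ^ 2}) π hsurj hmul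
  obtain ⟨p, hp⟩ := Ideal.Quotient.mk_surjective (σ (chartU a b c))
  obtain ⟨q, hq⟩ := Ideal.Quotient.mk_surjective (σ (chartV a b c))
  obtain ⟨s, hs⟩ : g ∣ p - .C .X := by
    rw [← AdjoinRoot.mk_eq_zero, map_sub, ← hπ, hp, hσ]
    exact sub_self _
  obtain ⟨t, ht⟩ : g ∣ q - .X := by
    rw [← AdjoinRoot.mk_eq_zero, map_sub, ← hπ, hq, hσ]
    exact sub_self _
  obtain rfl := sub_eq_iff_eq_add'.mp hs
  obtain rfl := sub_eq_iff_eq_add'.mp ht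
  have h0 : g ^ 2 ∣ affineQuartic (.C (.C a)) (.C (.C b)) (.C (.C c)) (.C .X + g * s)
      (.X + g * t) := by
    rw [← Ideal.mem_span_singleton, ← Ideal.Quotient.eq_zero_iff_mem]
    have := congr(σ $(chartRing_relation a b c))
    simp only [affineQuartic, map_add, map_mul, map_pow, map_one, map_ofNat, ← hp, ← hq,
      AlgHom.commutes, map_zero] at this ⊢
    exact this
  -- To first order the equation at the moved point is `g` times one plus a combination of the
  -- partials. The monic `g` cancels, so this second factor vanishes in the chart ring.
  have h1 := (dvd_iff_dvd_of_dvd_sub (affineQuartic_add_mul _ _ _ _ _ g s t)).mp h0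
  rw [affineQuartic_C_X, ← mul_one_add, pow_two] at h1
  obtain ⟨w, hw⟩ := h1
  have h2 := (chartPoly_monic a b c).isRegular.left (hw.trans (mul_assoc _ _ _))
  have h3 := congr(AdjoinRoot.mk g $h2)
  rw [Ideal.eq_top_iff_one, Ideal.mem_span_pair]
  refine ⟨-(4 * AdjoinRoot.mk g s), -(4 * AdjoinRoot.mk g t), ?_⟩
  have hA (r : R) : AdjoinRoot.mk g (.C (.C r)) = algebraMap R (ChartRing a b c) r := rfl
  have hU : AdjoinRoot.mk g (.C .X) = chartU a b c := rfl
  have hV : AdjoinRoot.mk g .X = chartV a b c := rfl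
  simp only [map_add, map_mul, map_pow, map_one, map_ofNat, AdjoinRoot.mk_self, hA, hU, hV,
    zero_mul] at h3
  simp only [chartDu, chartDv]
  linear_combination -h3

theorem not_formallySmooth_of_singular_point {K : Type*} [Field K] {a b c u v : K}
    (h : affineQuartic a b c u v = 0) (hu : u * (u ^ 2 + a + c * v ^ 2) = 0)
    (hv : v * (v ^ 2 + b + c * u ^ 2) = 0) : ¬ Algebra.FormallySmooth K (ChartRing a b c) := by
  intro _
  have h1 := span_chartDu_chartDv_eq_top_of_formallySmooth a b c
  rw [Ideal.eq_top_iff_one, Ideal.mem_span_pair] at h1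
  obtain ⟨s, t, hst⟩ := h1
  have := congr(chartLift (RingHom.id K) u v h $hst)
  simp [chartDu, chartDv, hu, hv] at this

end ChartSingular

/-! ### Integrality of the charts -/

section ChartDomain

/-- A root `r` gives `(r² + p)² = p² - q`. In a factorization `(X² + sX + t)(X² - sX + t')` the
linear coefficient gives `s (t' - t) = 0`: if `s = 0` then `p² - q = (t - p)²`, and if `t = t'` then
`q = t²`. -/
theorem irreducible_biquadratic {A : Type*} [CommRing A] [IsDomain A] {p q : A}
    (h1 : ¬ IsSquare (p ^ 2 - q)) (h2 : ¬ IsSquare q) :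
    Irreducible (.X ^ 4 + .C (2 * p) * .X ^ 2 + .C q : Polynomial A) := by
  have hm : (.X ^ 4 + .C (2 * p) * .X ^ 2 + .C q : Polynomial A).Monic := by monicity!
  have hd : (.X ^ 4 + .C (2 * p) * .X ^ 2 + .C q : Polynomial A).natDegree = 4 := by
    compute_degree!
  refine hm.irreducible_iff_natDegree'.mpr ⟨fun h => by
    rw [h, Polynomial.natDegree_one] at hd; omega, ?_⟩
  rw [hd]
  intro f g hf hg hfg hmem
  have hdeg : f.natDegree + g.natDegree = 4 := by rw [← hf.natDegree_mul hg, hfg, hd]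
  obtain h | h : g.natDegree = 1 ∨ g.natDegree = 2 := by
    rw [Finset.mem_Ioc] at hmem; omega
  · rw [hg.eq_X_add_C h] at hfg
    have := congr(Polynomial.eval (-g.coeff 0) $hfg)
    simp at this
    exact h1 ⟨g.coeff 0 ^ 2 + p, by linear_combination this⟩
  · have h' : f.natDegree = 2 := by omega
    have hf2 : f = .X ^ 2 + .C (f.coeff 1) * .X + .C (f.coeff 0) := by
      conv_lhs => rw [f.as_sum_range_C_mul_X_pow, h']
      have : f.coeff 2 = 1 := h' ▸ hf.coeff_natDegree
      simp [Finset.sum_range_succ, this]; ring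
    have hg2 : g = .X ^ 2 + .C (g.coeff 1) * .X + .C (g.coeff 0) := by
      conv_lhs => rw [g.as_sum_range_C_mul_X_pow, h]
      have : g.coeff 2 = 1 := h ▸ hg.coeff_natDegree
      simp [Finset.sum_range_succ, this]; ring
    generalize f.coeff 1 = s, f.coeff 0 = t at hf2
    generalize g.coeff 1 = s', g.coeff 0 = t' at hg2
    subst hf2 hg2
    have key : (.C (s + s') * .X ^ 3 + .C (t + t' + s * s' - 2 * p) * .X ^ 2 +
        .C (s * t' + s' * t) * .X + .C (t * t' - q) : Polynomial A) = 0 := by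
      simp only [map_add, map_sub, map_mul] at hfg ⊢
      linear_combination hfg
    have coeffs (α β γ δ : A) (h : (.C α * .X ^ 3 + .C β * .X ^ 2 + .C γ * .X + .C δ :
        Polynomial A) = 0) : α = 0 ∧ β = 0 ∧ γ = 0 ∧ δ = 0 := by
      have k3 := congr(Polynomial.coeff $h 3)
      have k2 := congr(Polynomial.coeff $h 2)
      have k1 := congr(Polynomial.coeff $h 1)
      have k0 := congr(Polynomial.coeff $h 0)
      simp [Polynomial.coeff_X, Polynomial.coeff_C, Polynomial.coeff_X_pow] at k3 k2 k1 k0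
      exact ⟨k3, k2, k1, k0⟩
    obtain ⟨k3, k2, k1, k0⟩ := coeffs _ _ _ _ key
    have hs : s' = -s := by linear_combination k3
    subst hs
    have : s * (t' - t) = 0 := by linear_combination k1
    rcases mul_eq_zero.mp this with rfl | h
    · exact h1 ⟨t - p, by linear_combination k0 - t * k2⟩
    · exact h2 ⟨t, by linear_combination t * h - k0⟩

variable {K : Type*} [Field K]

/-- A square root `q` divides the polynomial and its derivative. The Euclidean algorithm on these
ends in the nonzero constant `(B² - AC) C`, so `q` would be a unit, against degree 4. -/
theorem not_isSquare_biquadratic (h2 : (2 : K) ≠ 0) {A B C : K} (hA : A ≠ 0) (hC : C ≠ 0)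
    (h : B ^ 2 ≠ A * C) :
    ¬ IsSquare (.C A * .X ^ 4 + .C (2 * B) * .X ^ 2 + .C C : Polynomial K) := by
  rintro ⟨q, hq⟩
  have hd : (.C A * .X ^ 4 + .C (2 * B) * .X ^ 2 + .C C : Polynomial K).natDegree = 4 := by
    compute_degree!
  have hd' := congr(Polynomial.derivative $hq)
  simp only [Polynomial.derivative_add, Polynomial.derivative_X_pow, Polynomial.derivative_C,
    Polynomial.derivative_mul] at hd'
  norm_num [Polynomial.C_ofNat] at hd'
  have h2' : (2 : Polynomial K) ≠ 0 := by
    rw [← Polynomial.C_ofNat]; simpa using h2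
  have hdv : q ∣ .C A * .X ^ 3 + .C B * .X := by
    refine ⟨.C (1 / 2) * q.derivative, ?_⟩
    have : (2 : Polynomial K) * .C (1 / 2) = 1 := by
      rw [← Polynomial.C_ofNat, ← map_mul, ← map_one Polynomial.C]; simp [h2]
    refine mul_left_cancel₀ h2' (mul_left_cancel₀ h2' ?_)
    linear_combination hd' - 2 * q * q.derivative * this
  have h1 : q ∣ .C B * .X ^ 2 + .C C := by
    have : (.C B * .X ^ 2 + .C C : Polynomial K) = q * q - .X * (.C A * .X ^ 3 + .C B * .X) := by
      rw [← hq, map_mul, Polynomial.C_ofNat]; ring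
    rw [this]
    exact dvd_sub (dvd_mul_right _ _) (hdv.mul_left _)
  have hX : q ∣ .C (B ^ 2 - A * C) * .X := by
    have : (.C (B ^ 2 - A * C) * .X : Polynomial K) =
        .C B * (.C A * .X ^ 3 + .C B * .X) - .C A * .X * (.C B * .X ^ 2 + .C C) := by
      simp only [map_sub, map_mul, map_pow]; ring
    rw [this]
    exact dvd_sub (hdv.mul_left _) (h1.mul_left _)
  have hC' : q ∣ .C ((B ^ 2 - A * C) * C) := by
    have : (.C ((B ^ 2 - A * C) * C) : Polynomial K) = .C (B ^ 2 - A * C) * (.C B * .X ^ 2 + .C C) -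
        .C B * .X * (.C (B ^ 2 - A * C) * .X) := by
      simp only [map_sub, map_mul, map_pow]; ring
    rw [this]
    exact dvd_sub (h1.mul_left _) (hX.mul_left _)
  have hu : IsUnit q := isUnit_of_dvd_unit hC'
    (Polynomial.isUnit_C.mpr (mul_ne_zero (sub_ne_zero.mpr h) hC).isUnit)
  rw [hq, Polynomial.natDegree_eq_zero_of_isUnit (hu.mul hu)] at hd
  norm_num at hd

/-- Here `p = b + c u²` and `q = 1 + 2a u² + u⁴`. As quadratics in `u²`, `p² - q` and `q` have
quarter discriminants `symmDet a b c` and `a² - 1`. -/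
theorem isDomain_chartRing (h2 : (2 : K) ≠ 0) {a b c : K} (ha : a ^ 2 - 1 ≠ 0)
    (hb : b ^ 2 - 1 ≠ 0) (hc : c ^ 2 - 1 ≠ 0) (hd : symmDet a b c ≠ 0) :
    IsDomain (ChartRing a b c) := by
  refine AdjoinRoot.isDomain_of_prime (Irreducible.prime ?_)
  have hf : chartPoly a b c = .X ^ 4 + .C (2 * (.C b + .C c * .X ^ 2)) * .X ^ 2 +
      .C (1 + .C (2 * a) * .X ^ 2 + .X ^ 4) := by
    simp only [chartPoly, map_add, map_mul, map_ofNat]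
    ring
  rw [hf]
  refine irreducible_biquadratic ?_ ?_
  · have : ((.C b + .C c * .X ^ 2) ^ 2 - (1 + .C (2 * a) * .X ^ 2 + .X ^ 4) : Polynomial K) =
        .C (c ^ 2 - 1) * .X ^ 4 + .C (2 * (b * c - a)) * .X ^ 2 + .C (b ^ 2 - 1) := by
      simp only [map_sub, map_mul, map_ofNat, map_pow, map_one]
      ring
    rw [this]
    refine not_isSquare_biquadratic h2 hc hb fun h => hd ?_
    rw [symmDet]
    linear_combination h
  · have : (1 + .C (2 * a) * .X ^ 2 + .X ^ 4 : Polynomial K) =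
        .C 1 * .X ^ 4 + .C (2 * a) * .X ^ 2 + .C 1 := by
      simp only [map_one]
      ring
    rw [this]
    refine not_isSquare_biquadratic h2 one_ne_zero one_ne_zero fun h => ha ?_
    linear_combination h

end ChartDomain

/-! ### The standard affine charts of the plane quartics -/

section AwayCoord

open HomogeneousLocalization

variable {R : Type*} [CommRing R] (a b c : R)

/-- The homogeneous coordinate ring of the quartic. -/
abbrev QuarticRing : Type _ := MvPolynomial (Fin 3) R ⧸ Ideal.span {quarticForm a b c}

/-- The homogeneous coordinates. -/
def quarticCoord (i : Fin 3) : QuarticRing a b c := Ideal.Quotient.mk _ (.X i)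

theorem mk_mem_quarticGrading {n : ℕ} {P : MvPolynomial (Fin 3) R} (hP : P.IsHomogeneous n) :
    (Ideal.Quotient.mk _ P : QuarticRing a b c) ∈ quarticGrading a b c n :=
  ⟨P, hP, rfl⟩

theorem quarticCoord_mem (i : Fin 3) : quarticCoord a b c i ∈ quarticGrading a b c 1 :=
  mk_mem_quarticGrading a b c (MvPolynomial.isHomogeneous_X R i)

/-- The ring of functions on the chart where the coordinate `i` is invertible. -/
abbrev QuarticAway (i : Fin 3) : Type _ := Away (quarticGrading a b c) (quarticCoord a b c i)

/-- The structure homomorphism of `QuarticAway a b c i`. -/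
def awayC (i : Fin 3) : R →+* QuarticAway a b c i :=
  (fromZeroRingHom (quarticGrading a b c) _).comp (algebraMap R (quarticGrading a b c 0))

/-- The quotient of the coordinate `j` by the coordinate `i`. -/
def awayCoord (i j : Fin 3) : QuarticAway a b c i :=
  Away.mk _ (quarticCoord_mem a b c i) 1 (quarticCoord a b c j) (quarticCoord_mem a b c j)

theorem val_awayC (i : Fin 3) (r : R) :
    (awayC a b c i r).val = algebraMap (QuarticRing a b c) _ (Ideal.Quotient.mk _ (.C r)) :=
  Localization.mk_one_eq_algebraMap _

theorem val_awayCoord (i j : Fin 3) :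
    (awayCoord a b c i j).val * algebraMap (QuarticRing a b c) _ (quarticCoord a b c i) =
      algebraMap (QuarticRing a b c) _ (quarticCoord a b c j) := by
  rw [awayCoord, Away.val_mk, ← Localization.mk_one_eq_algebraMap,
    ← Localization.mk_one_eq_algebraMap, Localization.mk_mul, Localization.mk_eq_mk_iff,
    Localization.r_iff_exists]
  exact ⟨1, by simp; ring⟩

theorem isUnit_algebraMap_quarticCoord (i : Fin 3) : IsUnit (algebraMap (QuarticRing a b c)
    (Localization.Away (quarticCoord a b c i)) (quarticCoord a b c i)) :=
  IsLocalization.Away.algebraMap_isUnit _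

theorem awayCoord_self (i : Fin 3) : awayCoord a b c i i = 1 := by
  apply val_injective
  rw [val_one]
  exact (isUnit_algebraMap_quarticCoord a b c i).mul_right_cancel
    ((val_awayCoord a b c i i).trans (one_mul _).symm)

/-- Homogeneity, monomial by monomial: each of the `n` factors `xⱼ / xᵢ` absorbs one factor `xᵢ`. -/
theorem val_eval₂_awayCoord (i : Fin 3) {n : ℕ} {P : MvPolynomial (Fin 3) R}
    (hP : P.IsHomogeneous n) :
    (P.eval₂ (awayC a b c i) (awayCoord a b c i)).val *
      algebraMap (QuarticRing a b c) _ (quarticCoord a b c i) ^ n =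
      algebraMap (QuarticRing a b c) _ (Ideal.Quotient.mk _ P) := by
  set L := Localization.Away (quarticCoord a b c i)
  have hval : (P.eval₂ (awayC a b c i) (awayCoord a b c i)).val =
      P.eval₂ ((algebraMap (QuarticAway a b c i) L).comp (awayC a b c i))
        (fun j => (awayCoord a b c i j).val) :=
    MvPolynomial.eval₂_comp_left (algebraMap (QuarticAway a b c i) L) _ _ P
  have hmk : algebraMap (QuarticRing a b c) L (Ideal.Quotient.mk _ P) =
      P.eval₂ (((algebraMap (QuarticRing a b c) L).comp (Ideal.Quotient.mk _)).comp MvPolynomial.C)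
        (fun j => algebraMap (QuarticRing a b c) L (quarticCoord a b c j)) := by
    have := MvPolynomial.eval₂_comp_left ((algebraMap (QuarticRing a b c) L).comp
      (Ideal.Quotient.mk (Ideal.span {quarticForm a b c}))) MvPolynomial.C MvPolynomial.X P
    rw [MvPolynomial.eval₂_eta] at this
    exact this
  rw [hval, hmk, MvPolynomial.eval₂_eq', MvPolynomial.eval₂_eq', Finset.sum_mul]
  refine Finset.sum_congr rfl fun d hd => ?_
  have hn : ∑ j, d j = n := by
    have := hP (MvPolynomial.mem_support_iff.mp hd)
    rwa [Pi.one_def, ← Finsupp.degree_eq_weight_one, Finsupp.degree_eq_sum] at this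
  rw [mul_assoc, ← hn, ← Finset.prod_pow_eq_pow_sum, ← Finset.prod_mul_distrib]
  refine congr_arg₂ _ (val_awayC a b c i _) ?_
  exact Finset.prod_congr rfl fun j _ => by rw [← mul_pow, val_awayCoord]

/-- Consequently the chart is generated over `R` by the coordinate ratios. Together with
`quarticAwayLift` this gives its universal property, and no kernel has to be computed to identify it
with a `ChartRing`. -/
theorem awayMk_eq_eval₂ (i : Fin 3) {n : ℕ} {P : MvPolynomial (Fin 3) R} (hP : P.IsHomogeneous n)
    (h : Ideal.Quotient.mk _ P ∈ quarticGrading a b c (n • 1)) :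
    Away.mk _ (quarticCoord_mem a b c i) n (Ideal.Quotient.mk _ P) h =
      P.eval₂ (awayC a b c i) (awayCoord a b c i) := by
  apply val_injective
  refine ((isUnit_algebraMap_quarticCoord a b c i).pow n).mul_right_cancel ?_
  rw [val_eval₂_awayCoord a b c i hP, Away.val_mk, ← map_pow, ← Localization.mk_one_eq_algebraMap,
    ← Localization.mk_one_eq_algebraMap, Localization.mk_mul, Localization.mk_eq_mk_iff,
    Localization.r_iff_exists]
  exact ⟨1, by simp; ring⟩

theorem eval₂_awayCoord_surjective (i : Fin 3) (x : QuarticAway a b c i) :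
    ∃ P : MvPolynomial (Fin 3) R, P.eval₂ (awayC a b c i) (awayCoord a b c i) = x := by
  obtain ⟨n, _, ⟨P, hP, rfl⟩, rfl⟩ := Away.mk_surjective _ (quarticCoord_mem a b c i) x
  rw [smul_eq_mul, mul_one] at hP
  exact ⟨P, (awayMk_eq_eval₂ a b c i hP _).symm⟩

theorem eval₂_awayCoord_quarticForm (i : Fin 3) :
    (quarticForm a b c).eval₂ (awayC a b c i) (awayCoord a b c i) = 0 := by
  apply val_injective
  refine ((isUnit_algebraMap_quarticCoord a b c i).pow 4).mul_right_cancel ?_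
  rw [val_eval₂_awayCoord a b c i (quarticForm_isHomogeneous a b c), val_zero, zero_mul,
    Ideal.Quotient.eq_zero_iff_mem.mpr (Ideal.mem_span_singleton_self _), map_zero]

variable {a b c} {T : Type*} [CommRing T]

theorem quarticAway_hom_ext {i : Fin 3} {f g : QuarticAway a b c i →+* T}
    (hC : ∀ r, f (awayC a b c i r) = g (awayC a b c i r))
    (hX : ∀ j, f (awayCoord a b c i j) = g (awayCoord a b c i j)) : f = g := by
  refine RingHom.ext fun x => ?_
  obtain ⟨P, rfl⟩ := eval₂_awayCoord_surjective a b c i x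
  rw [MvPolynomial.eval₂_comp_left, MvPolynomial.eval₂_comp_left, RingHom.ext (f := f.comp _)
    (g := g.comp _) hC,
    funext (f := f ∘ _) (g := g ∘ _) hX]

/-- A solution `w` of the equation determines a homomorphism out of the coordinate ring. -/
def quarticRingLift (φ : R →+* T) (w : Fin 3 → T) (hw : (quarticForm a b c).eval₂ φ w = 0) :
    QuarticRing a b c →+* T :=
  Ideal.Quotient.lift (Ideal.span {quarticForm a b c}) (MvPolynomial.eval₂Hom φ w) (fun p hp => by
    obtain ⟨q, rfl⟩ := Ideal.mem_span_singleton.mp hp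
    rw [map_mul, MvPolynomial.coe_eval₂Hom, hw, zero_mul])

@[simp]
theorem quarticRingLift_mk (φ : R →+* T) (w : Fin 3 → T)
    (hw : (quarticForm a b c).eval₂ φ w = 0) (P : MvPolynomial (Fin 3) R) :
    quarticRingLift φ w hw (Ideal.Quotient.mk _ P) = P.eval₂ φ w := rfl

@[simp]
theorem quarticRingLift_quarticCoord (φ : R →+* T) (w : Fin 3 → T)
    (hw : (quarticForm a b c).eval₂ φ w = 0) (j : Fin 3) :
    quarticRingLift φ w hw (quarticCoord a b c j) = w j :=
  MvPolynomial.eval₂_X _ _ _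

section

variable {i : Fin 3} (φ : R →+* T) (w : Fin 3 → T) (hi : w i = 1)
  (hw : (quarticForm a b c).eval₂ φ w = 0)

include hi in
theorem isUnit_quarticRingLift : IsUnit (quarticRingLift φ w hw (quarticCoord a b c i)) := by
  rw [quarticRingLift_quarticCoord, hi]
  exact isUnit_one

/-- A solution `w` of the equation with `w i = 1` determines a homomorphism out of the ring
of functions on the chart where the coordinate `i` is invertible. -/
def quarticAwayLift : QuarticAway a b c i →+* T :=
  (IsLocalization.Away.lift (S := Localization.Away (quarticCoord a b c i)) (quarticCoord a b c i)
    (isUnit_quarticRingLift φ w hi hw)).comp (algebraMap _ _)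

theorem quarticAwayLift_apply (x) : quarticAwayLift φ w hi hw x =
    IsLocalization.Away.lift (S := Localization.Away (quarticCoord a b c i))
      (quarticCoord a b c i) (isUnit_quarticRingLift φ w hi hw) x.val := rfl

@[simp]
theorem quarticAwayLift_awayC (r : R) : quarticAwayLift φ w hi hw (awayC a b c i r) = φ r := by
  rw [quarticAwayLift_apply, val_awayC, IsLocalization.Away.lift_eq]
  simp

@[simp]
theorem quarticAwayLift_awayCoord (j : Fin 3) :
    quarticAwayLift φ w hi hw (awayCoord a b c i j) = w j := by
  have := congr(IsLocalization.Away.lift (S := Localization.Away (quarticCoord a b c i))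
    (quarticCoord a b c i) (isUnit_quarticRingLift φ w hi hw) $(val_awayCoord a b c i j))
  rw [map_mul, IsLocalization.Away.lift_eq, IsLocalization.Away.lift_eq] at this
  rw [quarticRingLift_quarticCoord, quarticRingLift_quarticCoord, hi, mul_one] at this
  exact this

end

theorem eval₂_quarticForm (φ : R →+* T) (w : Fin 3 → T) : (quarticForm a b c).eval₂ φ w =
    w 0 ^ 4 + w 1 ^ 4 + w 2 ^ 4 + 2 * φ a * w 0 ^ 2 * w 1 ^ 2 + 2 * φ b * w 0 ^ 2 * w 2 ^ 2
      + 2 * φ c * w 1 ^ 2 * w 2 ^ 2 := by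
  simp [quarticForm]

variable (a b c)

/-- The tautological point of the chart where `x` is invertible. -/
def pointX : Fin 3 → ChartRing a b c := ![1, chartU a b c, chartV a b c]

@[simp] theorem pointX_zero : pointX a b c 0 = 1 := rfl
@[simp] theorem pointX_one : pointX a b c 1 = chartU a b c := rfl
@[simp] theorem pointX_two : pointX a b c 2 = chartV a b c := rfl

theorem eval₂_quarticForm_pointX :
    (quarticForm a b c).eval₂ (algebraMap R (ChartRing a b c)) (pointX a b c) = 0 := by
  rw [eval₂_quarticForm, ← chartRing_relation a b c]
  simp [affineQuartic]

theorem affineQuartic_awayCoord_zero : affineQuartic (awayC a b c 0 a) (awayC a b c 0 b)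
    (awayC a b c 0 c) (awayCoord a b c 0 1) (awayCoord a b c 0 2) = 0 := by
  have := eval₂_awayCoord_quarticForm a b c 0
  rw [eval₂_quarticForm, awayCoord_self] at this
  rw [← this]
  simp [affineQuartic]

/-- The tautological point of the chart where `y` is invertible. -/
def pointY : Fin 3 → ChartRing a c b := ![chartU a c b, 1, chartV a c b]

@[simp] theorem pointY_zero : pointY a b c 0 = chartU a c b := rfl
@[simp] theorem pointY_one : pointY a b c 1 = 1 := rfl
@[simp] theorem pointY_two : pointY a b c 2 = chartV a c b := rfl

theorem eval₂_quarticForm_pointY :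
    (quarticForm a b c).eval₂ (algebraMap R (ChartRing a c b)) (pointY a b c) = 0 := by
  rw [eval₂_quarticForm, ← chartRing_relation a c b]
  simp only [affineQuartic, pointY_zero, pointY_one, pointY_two]
  ring

theorem affineQuartic_awayCoord_one : affineQuartic (awayC a b c 1 a) (awayC a b c 1 c)
    (awayC a b c 1 b) (awayCoord a b c 1 0) (awayCoord a b c 1 2) = 0 := by
  have := eval₂_awayCoord_quarticForm a b c 1
  rw [eval₂_quarticForm, awayCoord_self] at this
  rw [← this]
  simp only [affineQuartic]
  ring

/-- The chart where `x` is invertible. -/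
def chartEquivX : QuarticAway a b c 0 ≃+* ChartRing a b c :=
  RingEquiv.ofRingHom
    (quarticAwayLift (algebraMap R _) (pointX a b c) (pointX_zero a b c)
      (eval₂_quarticForm_pointX a b c))
    (chartLift (awayC a b c 0) (awayCoord a b c 0 1) (awayCoord a b c 0 2)
      (affineQuartic_awayCoord_zero a b c))
    (chartRing_hom_ext (by simp) (by simp) (by simp))
    (quarticAway_hom_ext (by simp) (fun j => by fin_cases j <;> simp [awayCoord_self]))

/-- The chart where `y` is invertible. -/
def chartEquivY : QuarticAway a b c 1 ≃+* ChartRing a c b :=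
  RingEquiv.ofRingHom
    (quarticAwayLift (algebraMap R _) (pointY a b c) (pointY_one a b c)
      (eval₂_quarticForm_pointY a b c))
    (chartLift (awayC a b c 1) (awayCoord a b c 1 0) (awayCoord a b c 1 2)
      (affineQuartic_awayCoord_one a b c))
    (chartRing_hom_ext (by simp) (by simp) (by simp))
    (quarticAway_hom_ext (by simp) (fun j => by fin_cases j <;> simp [awayCoord_self]))

@[simp]
theorem chartEquivX_awayC (r : R) : chartEquivX a b c (awayC a b c 0 r) = algebraMap R _ r := by
  simp [chartEquivX]

@[simp]
theorem chartEquivX_awayCoord_one : chartEquivX a b c (awayCoord a b c 0 1) = chartU a b c := by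
  simp [chartEquivX]

@[simp]
theorem chartEquivX_awayCoord_two : chartEquivX a b c (awayCoord a b c 0 2) = chartV a b c := by
  simp [chartEquivX]

@[simp]
theorem chartEquivY_awayC (r : R) : chartEquivY a b c (awayC a b c 1 r) = algebraMap R _ r := by
  simp [chartEquivY]

@[simp]
theorem chartEquivY_awayCoord_zero : chartEquivY a b c (awayCoord a b c 1 0) = chartU a c b := by
  simp [chartEquivY]

@[simp]
theorem chartEquivY_awayCoord_two : chartEquivY a b c (awayCoord a b c 1 2) = chartV a c b := by
  simp [chartEquivY]

end AwayCoord

/-! ### Two charts cover the quartic -/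

section Cover

variable {R : Type u} [CommRing R] (a b c : R)

/-- Setting `x = y = 0` in the form leaves `z⁴`, so no point of the curve has `x = y = 0`. -/
theorem quarticCoord_relation : quarticCoord a b c 2 ^ 4 ∈
    Ideal.span {quarticCoord a b c 0, quarticCoord a b c 1} := by
  have h : (.X 2 ^ 4 : MvPolynomial (Fin 3) R) = quarticForm a b c -
      (.X 0 ^ 3 + 2 * .C a * .X 0 * .X 1 ^ 2 + 2 * .C b * .X 0 * .X 2 ^ 2) * .X 0 -
      (.X 1 ^ 3 + 2 * .C c * .X 1 * .X 2 ^ 2) * .X 1 := by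
    rw [quarticForm]; ring
  have h0 : (Ideal.Quotient.mk _ (quarticForm a b c) : QuarticRing a b c) = 0 :=
    Ideal.Quotient.eq_zero_iff_mem.mpr (Ideal.mem_span_singleton_self _)
  have h1 : quarticCoord a b c 2 ^ 4 = Ideal.Quotient.mk _ (.X 2 ^ 4) := (map_pow _ _ _).symm
  rw [h1, h, map_sub, map_sub, h0, map_mul, map_mul, zero_sub]
  exact sub_mem (neg_mem (Ideal.mul_mem_left _ _ (Ideal.subset_span (Or.inl rfl))))
    (Ideal.mul_mem_left _ _ (Ideal.subset_span (Or.inr rfl)))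

theorem mem_span_quarticCoord {n : ℕ} (hn : 0 < n) {x : QuarticRing a b c}
    (hx : x ∈ quarticGrading a b c n) : x ∈ Ideal.span (Set.range (quarticCoord a b c)) := by
  obtain ⟨P, hP, rfl⟩ := hx
  have hP' : P ∈ Ideal.span (Set.range (MvPolynomial.X : Fin 3 → MvPolynomial (Fin 3) R)) := by
    rw [← Set.image_univ, MvPolynomial.mem_ideal_span_X_image]
    intro d hd
    have := hP (MvPolynomial.mem_support_iff.mp hd)
    by_contra! h
    rw [show d = 0 from Finsupp.ext fun i => h i (Set.mem_univ i), map_zero] at this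
    omega
  have := Ideal.mem_map_of_mem (Ideal.Quotient.mk (Ideal.span {quarticForm a b c})) hP'
  rw [Ideal.map_span, ← Set.range_comp] at this
  exact this

theorem irrelevant_le_span_quarticCoord :
    (HomogeneousIdeal.irrelevant (quarticGrading a b c)).toIdeal ≤
      Ideal.span (Set.range (quarticCoord a b c)) := by
  rw [HomogeneousIdeal.toIdeal_irrelevant_le]
  exact fun n hn x hx => mem_span_quarticCoord a b c hn hx

theorem exists_mem_basicOpen_quarticCoord (p : Proj (quarticGrading a b c)) :
    p ∈ Proj.basicOpen (quarticGrading a b c) (quarticCoord a b c 0) ∨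
      p ∈ Proj.basicOpen (quarticGrading a b c) (quarticCoord a b c 1) := by
  by_contra! h
  rw [Proj.mem_basicOpen, Proj.mem_basicOpen, not_not, not_not] at h
  have h2 : quarticCoord a b c 2 ∈ p.asHomogeneousIdeal.toIdeal := by
    refine p.isPrime.mem_of_pow_mem 4 (Ideal.span_le.mpr ?_ (quarticCoord_relation a b c))
    rintro _ (rfl | rfl)
    exacts [h.1, h.2]
  refine p.not_irrelevant_le ((irrelevant_le_span_quarticCoord a b c).trans (Ideal.span_le.mpr ?_))
  rintro _ ⟨i, rfl⟩
  fin_cases i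
  exacts [h.1, h.2, h2]

open Classical in
/-- The affine open cover of the quartic by the charts where `x` or `y` is invertible. -/
def quarticCover : (Proj (quarticGrading a b c)).AffineOpenCover where
  I₀ := Fin 2
  X i := .of (QuarticAway a b c i.castSucc)
  f i := Proj.awayι (quarticGrading a b c) _ (quarticCoord_mem a b c i.castSucc) one_pos
  idx p := if p ∈ Proj.basicOpen (quarticGrading a b c) (quarticCoord a b c 0) then 0 else 1
  covers p := by
    change p ∈ (Proj.awayι _ _ _ _).opensRange
    rw [Proj.opensRange_awayι]
    split_ifs with h
    · exact h
    · exact (exists_mem_basicOpen_quarticCoord a b c p).resolve_left h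
end Cover

/-! ### Base change -/

/-- Being a pullback is local on `X`. By `H` the `V i` are the preimages in `W` of the members of
the cover, and by `H'` they are the required fibre products. -/
theorem isPullback_of_isPullback_cover {W X Y Z : Scheme.{u}} {fWX : W ⟶ X} {fWY : W ⟶ Y}
    {fXZ : X ⟶ Z} {fYZ : Y ⟶ Z} (𝒰 : X.OpenCover) {V : 𝒰.I₀ → Scheme.{u}}
    (g : ∀ i, V i ⟶ 𝒰.X i) (j : ∀ i, V i ⟶ W) (H : ∀ i, IsPullback (g i) (j i) (𝒰.f i) fWX)
    (H' : ∀ i, IsPullback (g i) (j i ≫ fWY) (𝒰.f i ≫ fXZ) fYZ) :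
    IsPullback fWX fWY fXZ fYZ := by
  refine Scheme.isPullback_of_openCover _ _ _ _ 𝒰 fun i => ?_
  let e := (H i).flip.isoPullback
  refine IsPullback.of_iso (H' i) e (Iso.refl _) (Iso.refl _) (Iso.refl _) ?_ ?_ (by simp) (by simp)
  · exact (Category.comp_id _).trans ((H i).flip.isoPullback_hom_snd).symm
  · have := congr($((H i).flip.isoPullback_hom_fst) ≫ fWY)
    exact (Category.comp_id _).trans (this.symm.trans (Category.assoc _ _ _))

section ProjMap

open HomogeneousLocalization HomogeneousIdeal

variable {A B σ τ : Type u} [CommRing A] [SetLike σ A] [AddSubgroupClass σ A]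
  [CommRing B] [SetLike τ B] [AddSubgroupClass τ B] {𝒜 : ℕ → σ} {ℬ : ℕ → τ}
  [GradedRing 𝒜] [GradedRing ℬ] (f : 𝒜 →+*ᵍ ℬ)

/-- Keeping `t` apart from `f s` lets the lemma apply to coordinates that equal `f s` only
propositionally, without transport between localizations. -/
theorem exists_awayMap_of_eq (hf : ℬ₊ ≤ 𝒜₊.map f) {s : A} (hs : s ∈ 𝒜 1) {t : B}
    (ht : t ∈ ℬ 1) (h : f s = t) : ∃ ψ : Away 𝒜 s →+* Away ℬ t,
      (∀ n x (hx : x ∈ 𝒜 (n • 1)) (hx' : f x ∈ ℬ (n • 1)),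
        ψ (Away.mk 𝒜 hs n x hx) = Away.mk ℬ ht n (f x) hx') ∧
      IsPullback (Spec.map (CommRingCat.ofHom ψ)) (Proj.awayι ℬ t ht one_pos)
        (Proj.awayι 𝒜 s hs one_pos) (Proj.map f hf) := by
  subst h
  refine ⟨Away.map f s, fun n x hx _ => Away.map_mk f s hs n x hx, ?_⟩
  refine IsOpenImmersion.isPullback _ _ _ _ (Proj.awayι_comp_map f hf one_pos s hs) ?_
  rw [Proj.opensRange_awayι, Proj.opensRange_awayι, Proj.map_preimage_basicOpen]

end ProjMap

section

variable {R : Type u} [CommRing R] (a b c : R)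

theorem awayι_comp_toSpec (i : Fin 3) :
    Proj.awayι (quarticGrading a b c) _ (quarticCoord_mem a b c i) one_pos ≫
      planeQuarticToSpec a b c = Spec.map (CommRingCat.ofHom (awayC a b c i)) := by
  rw [planeQuarticToSpec]
  refine (Category.assoc _ _ _).symm.trans ?_
  rw [Proj.awayι_toSpecZero, ← Spec.map_comp, ← CommRingCat.ofHom_comp]
  rfl

end

section BaseChange

open HomogeneousLocalization HomogeneousIdeal

variable {R R' : Type u} [CommRing R] [CommRing R'] (φ : R →+* R') (a b c : R)

theorem map_quarticForm :
    MvPolynomial.map φ (quarticForm a b c) = quarticForm (φ a) (φ b) (φ c) := by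
  simp [quarticForm]

/-- The homomorphism of homogeneous coordinate rings induced by a change of coefficients. -/
def quarticRingMap : QuarticRing a b c →+* QuarticRing (φ a) (φ b) (φ c) :=
  Ideal.Quotient.lift _ ((Ideal.Quotient.mk _).comp (MvPolynomial.map φ)) (fun p hp => by
    obtain ⟨q, rfl⟩ := Ideal.mem_span_singleton.mp hp
    refine Ideal.Quotient.eq_zero_iff_mem.mpr ?_
    rw [map_mul, map_quarticForm]
    exact Ideal.mul_mem_right _ _ (Ideal.mem_span_singleton_self _))

theorem quarticRingMap_quarticCoord (i : Fin 3) :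
    quarticRingMap φ a b c (quarticCoord a b c i) = quarticCoord (φ a) (φ b) (φ c) i :=
  congr_arg (Ideal.Quotient.mk _) (MvPolynomial.map_X φ i)

/-- `quarticRingMap` as a homomorphism of graded rings. -/
def quarticGradedMap : quarticGrading a b c →+*ᵍ quarticGrading (φ a) (φ b) (φ c) where
  __ := quarticRingMap φ a b c
  map_mem := by
    rintro n _ ⟨P, hP, rfl⟩
    exact mk_mem_quarticGrading _ _ _ (MvPolynomial.IsHomogeneous.map hP φ)

theorem irrelevant_le_map_of_quarticCoord {A σ : Type*} [CommRing A] [SetLike σ A]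
    [AddSubgroupClass σ A] {𝒜 : ℕ → σ} [GradedRing 𝒜] (f : 𝒜 →+*ᵍ quarticGrading a b c)
    (x : Fin 3 → A) (hx : ∀ i, x i ∈ 𝒜 1) (hf : ∀ i, f (x i) = quarticCoord a b c i) :
    (quarticGrading a b c)₊ ≤ 𝒜₊.map f := by
  rw [← toIdeal_le_toIdeal_iff]
  refine (irrelevant_le_span_quarticCoord a b c).trans (Ideal.span_le.mpr ?_)
  rintro _ ⟨i, rfl⟩
  rw [← hf i]
  exact Ideal.mem_map_of_mem _ (HomogeneousIdeal.mem_irrelevant_of_mem _ one_pos (hx i))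

theorem irrelevant_le_map_quarticGradedMap :
    (quarticGrading (φ a) (φ b) (φ c))₊ ≤ (quarticGrading a b c)₊.map (quarticGradedMap φ a b c) :=
  irrelevant_le_map_of_quarticCoord _ _ _ _ (quarticCoord a b c) (quarticCoord_mem a b c)
    (quarticRingMap_quarticCoord φ a b c)

/-- The morphism of quartics induced by a change of coefficients. -/
def quarticMap : planeQuartic (φ a) (φ b) (φ c) ⟶ planeQuartic a b c :=
  Proj.map (quarticGradedMap φ a b c) (irrelevant_le_map_quarticGradedMap φ a b c)

/-- Both sides represent the solutions of the same equation normalized by `w i = 1`. -/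
theorem isPushout_quarticAway {i : Fin 3}
    (ψ : QuarticAway a b c i →+* QuarticAway (φ a) (φ b) (φ c) i)
    (hC : ∀ r, ψ (awayC a b c i r) = awayC _ _ _ i (φ r))
    (hX : ∀ j, ψ (awayCoord a b c i j) = awayCoord _ _ _ i j) :
    IsPushout (CommRingCat.ofHom (awayC a b c i)) (CommRingCat.ofHom φ)
      (CommRingCat.ofHom ψ) (CommRingCat.ofHom (awayC (φ a) (φ b) (φ c) i)) := by
  refine ⟨⟨CommRingCat.hom_ext (RingHom.ext hC)⟩, ⟨PushoutCocone.IsColimit.mk _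
    (fun s => CommRingCat.ofHom (quarticAwayLift (a := φ a) (b := φ b) (c := φ c) (i := i)
      s.inr.hom (fun j => s.inl.hom (awayCoord a b c i j)) ?_ ?_)) ?_ ?_ ?_⟩⟩
  · rw [awayCoord_self, map_one]
  · have h := congr(s.inl.hom $(eval₂_awayCoord_quarticForm a b c i))
    have hs (r : R) : s.inl.hom (awayC a b c i r) = s.inr.hom (φ r) :=
      congr($(s.condition).hom r)
    rw [eval₂_quarticForm, map_zero] at h
    have h2 : s.inl.hom 2 = 2 := map_ofNat _ 2
    rw [eval₂_quarticForm, ← h]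
    simp [hs, h2]
  · intro s
    ext1
    refine quarticAway_hom_ext (fun r => ?_) (fun j => ?_)
    · simpa [hC] using congr($(s.condition).hom r).symm
    · simp [hX]
  · intro s
    ext r
    simp
  · intro s m h1 h2
    ext1
    refine quarticAway_hom_ext (fun r => ?_) (fun j => ?_)
    · simpa using congr($(h2).hom r)
    · simpa [hX] using congr($(h1).hom (awayCoord a b c i j))

theorem isPullback_quarticMap : IsPullback (quarticMap φ a b c)
    (planeQuarticToSpec (φ a) (φ b) (φ c)) (planeQuarticToSpec a b c)
    (Spec.map (CommRingCat.ofHom φ)) := by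
  have H (i : Fin 3) := exists_awayMap_of_eq (quarticGradedMap φ a b c)
    (irrelevant_le_map_quarticGradedMap φ a b c) (quarticCoord_mem a b c i)
    (quarticCoord_mem (φ a) (φ b) (φ c) i) (quarticRingMap_quarticCoord φ a b c i)
  choose ψ hψ hP using H
  -- Applied to constants and to the variables, this shows that `ψ` respects coefficients and
  -- coordinate ratios.
  have hmk (i : Fin 3) {n : ℕ} {P : MvPolynomial (Fin 3) R} (hP : P.IsHomogeneous n) :
      ψ i (P.eval₂ (awayC a b c i) (awayCoord a b c i)) =
        (P.map φ).eval₂ (awayC _ _ _ i) (awayCoord _ _ _ i) := by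
    have hn : n • 1 = n := by simp
    rw [← awayMk_eq_eval₂ _ _ _ i hP (hn.symm ▸ mk_mem_quarticGrading a b c hP),
      ← awayMk_eq_eval₂ _ _ _ i (hP.map φ) (hn.symm ▸ mk_mem_quarticGrading _ _ _ (hP.map φ))]
    exact hψ i _ _ _ (hn.symm ▸ mk_mem_quarticGrading _ _ _ (hP.map φ))
  refine isPullback_of_isPullback_cover (quarticCover a b c).openCover
    (V := fun i => Spec (.of (QuarticAway (φ a) (φ b) (φ c) i.castSucc)))
    (fun i => Spec.map (CommRingCat.ofHom (ψ i.castSucc)))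
    (fun i => Proj.awayι _ _ (quarticCoord_mem (φ a) (φ b) (φ c) i.castSucc) one_pos)
    (fun i => hP i.castSucc) fun i => ?_
  have hpush := isPushout_quarticAway φ a b c (ψ (Fin.castSucc i)) (fun r => ?_) (fun j => ?_)
  · have := isPullback_SpecMap_of_isPushout _ _ _ _ hpush
    rw [← awayι_comp_toSpec, ← awayι_comp_toSpec] at this
    exact this
  · simpa using hmk (Fin.castSucc i) (MvPolynomial.isHomogeneous_C (Fin 3) r)
  · simpa using hmk (Fin.castSucc i) (MvPolynomial.isHomogeneous_X R j)

end BaseChange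

/-! ### Charts, smoothness and integrality -/

section Charts

open HomogeneousLocalization

variable {R : Type u} [CommRing R] (a b c : R)

/-- The chart where the coordinate `i` is invertible, as an open immersion. -/
def awayChart (i : Fin 3) : Spec (.of (QuarticAway a b c i)) ⟶ planeQuartic a b c :=
  Proj.awayι (quarticGrading a b c) _ (quarticCoord_mem a b c i) one_pos

instance (i : Fin 3) : IsOpenImmersion (awayChart a b c i) :=
  inferInstanceAs (IsOpenImmersion (Proj.awayι _ _ _ _))

theorem opensRange_awayChart (i : Fin 3) : (awayChart a b c i).opensRange =
    Proj.basicOpen (quarticGrading a b c) (quarticCoord a b c i) :=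
  Proj.opensRange_awayι _ _ _ _

theorem awayChart_comp_toSpec (i : Fin 3) : awayChart a b c i ≫ planeQuarticToSpec a b c =
    Spec.map (CommRingCat.ofHom (awayC a b c i)) :=
  awayι_comp_toSpec a b c i

/-- The chart where `x` is invertible, with its coordinates `y / x` and `z / x`. -/
def chartX : Spec (.of (ChartRing a b c)) ⟶ planeQuartic a b c :=
  Spec.map (chartEquivX a b c).toCommRingCatIso.hom ≫ awayChart a b c 0

/-- The chart where `y` is invertible, with its coordinates `x / y` and `z / y`. -/
def chartY : Spec (.of (ChartRing a c b)) ⟶ planeQuartic a b c :=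
  Spec.map (chartEquivY a b c).toCommRingCatIso.hom ≫ awayChart a b c 1

instance : IsOpenImmersion (chartX a b c) := by
  unfold chartX; infer_instance

instance : IsOpenImmersion (chartY a b c) := by
  unfold chartY; infer_instance

theorem chartX_comp_toSpec : chartX a b c ≫ planeQuarticToSpec a b c =
    Spec.map (CommRingCat.ofHom (algebraMap R (ChartRing a b c))) := by
  rw [chartX, Category.assoc, awayChart_comp_toSpec, ← Spec.map_comp]
  exact congr_arg Spec.map (CommRingCat.hom_ext (RingHom.ext fun r => chartEquivX_awayC a b c r))

theorem chartY_comp_toSpec : chartY a b c ≫ planeQuarticToSpec a b c =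
    Spec.map (CommRingCat.ofHom (algebraMap R (ChartRing a c b))) := by
  rw [chartY, Category.assoc, awayChart_comp_toSpec, ← Spec.map_comp]
  exact congr_arg Spec.map (CommRingCat.hom_ext (RingHom.ext fun r => chartEquivY_awayC a b c r))

theorem opensRange_chartX : (chartX a b c).opensRange =
    Proj.basicOpen (quarticGrading a b c) (quarticCoord a b c 0) :=
  (Scheme.Hom.opensRange_comp_of_isIso _ _).trans (opensRange_awayChart a b c 0)

theorem opensRange_chartY : (chartY a b c).opensRange =
    Proj.basicOpen (quarticGrading a b c) (quarticCoord a b c 1) :=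
  (Scheme.Hom.opensRange_comp_of_isIso _ _).trans (opensRange_awayChart a b c 1)

theorem mem_opensRange_chart (p : planeQuartic a b c) :
    p ∈ (chartX a b c).opensRange ∨ p ∈ (chartY a b c).opensRange := by
  rw [opensRange_chartX, opensRange_chartY]
  exact exists_mem_basicOpen_quarticCoord a b c p

/-- The ring of functions on the intersection of the two charts. -/
abbrev OverlapRing : Type u :=
  Away (quarticGrading a b c) (quarticCoord a b c 0 * quarticCoord a b c 1)

/-- Restriction from the chart where `x` is invertible to the overlap. -/
def overlapX : ChartRing a b c →+* OverlapRing a b c :=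
  (awayMap (quarticGrading a b c) (quarticCoord_mem a b c 1) rfl).comp (chartEquivX a b c).symm

/-- Restriction from the chart where `y` is invertible to the overlap. -/
def overlapY : ChartRing a c b →+* OverlapRing a b c :=
  (awayMap (quarticGrading a b c) (quarticCoord_mem a b c 0) (mul_comm _ _)).comp
    (chartEquivY a b c).symm

theorem quarticCoord_mul_mem : quarticCoord a b c 0 * quarticCoord a b c 1 ∈
    quarticGrading a b c (1 + 1) :=
  SetLike.GradedMul.mul_mem (quarticCoord_mem a b c 0) (quarticCoord_mem a b c 1)

/-- The intersection of the two charts, as an open immersion. -/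
def overlapChart : Spec (.of (OverlapRing a b c)) ⟶ planeQuartic a b c :=
  Proj.awayι (quarticGrading a b c) _ (quarticCoord_mul_mem a b c) two_pos

instance : IsOpenImmersion (overlapChart a b c) :=
  inferInstanceAs (IsOpenImmersion (Proj.awayι _ _ _ _))

theorem opensRange_overlapChart : (overlapChart a b c).opensRange =
    (chartX a b c).opensRange ⊓ (chartY a b c).opensRange := by
  rw [opensRange_chartX, opensRange_chartY]
  exact (Proj.opensRange_awayι _ _ _ _).trans (Proj.basicOpen_mul _ _ _)

theorem overlapX_comp_chartX : Spec.map (CommRingCat.ofHom (overlapX a b c)) ≫ chartX a b c =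
    overlapChart a b c := by
  have hX : Spec.map (CommRingCat.ofHom (overlapX a b c)) ≫ chartX a b c =
      Spec.map (CommRingCat.ofHom (awayMap (quarticGrading a b c) (quarticCoord_mem a b c 1) rfl)) ≫
        awayChart a b c 0 := by
    rw [chartX, ← Category.assoc, ← Spec.map_comp]
    congr 2
    ext x
    simp [overlapX]
  rw [hX]
  exact Proj.SpecMap_awayMap_awayι _ _ _ _ _

theorem overlapY_comp_chartY : Spec.map (CommRingCat.ofHom (overlapY a b c)) ≫ chartY a b c =
    overlapChart a b c := by
  have hY : Spec.map (CommRingCat.ofHom (overlapY a b c)) ≫ chartY a b c =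
      Spec.map (CommRingCat.ofHom (awayMap (quarticGrading a b c) (quarticCoord_mem a b c 0)
        (mul_comm _ _))) ≫
        awayChart a b c 1 := by
    rw [chartY, ← Category.assoc, ← Spec.map_comp]
    congr 2
    ext x
    simp [overlapY]
  rw [hY]
  exact Proj.SpecMap_awayMap_awayι _ _ _ _ _

/-- On the overlap the ratio `xₗ / xᵢ` is still characterized by its product with the unit `xᵢ`; the
transition formulas follow by cancelling units. -/
theorem val_awayMap_awayCoord {i j : Fin 3} {x : QuarticRing a b c}
    (hx : x = quarticCoord a b c i * quarticCoord a b c j) (l : Fin 3) :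
    (awayMap (quarticGrading a b c) (quarticCoord_mem a b c j) hx (awayCoord a b c i l)).val *
      algebraMap (QuarticRing a b c) _ (quarticCoord a b c i) =
      algebraMap (QuarticRing a b c) _ (quarticCoord a b c l) := by
  have hu : IsUnit (algebraMap (QuarticRing a b c) (Localization.Away x) (quarticCoord a b c i)) :=
    isUnit_of_dvd_unit (map_dvd _ ⟨_, hx⟩) (IsLocalization.Away.algebraMap_isUnit x)
  have := congr(Localization.awayLift (algebraMap (QuarticRing a b c) (Localization.Away x))
    (quarticCoord a b c i) hu $(val_awayCoord a b c i l))
  rw [map_mul] at this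
  rw [val_awayMap]
  simpa [Localization.awayLift] using this

theorem isUnit_quarticCoord_overlap (i : Fin 2) : IsUnit (algebraMap (QuarticRing a b c)
    (Localization.Away (quarticCoord a b c 0 * quarticCoord a b c 1))
    (quarticCoord a b c i.castSucc)) := by
  have h := IsLocalization.Away.algebraMap_isUnit
    (S := Localization.Away (quarticCoord a b c 0 * quarticCoord a b c 1))
    (quarticCoord a b c 0 * quarticCoord a b c 1)
  rw [map_mul, IsUnit.mul_iff] at h
  fin_cases i
  exacts [h.1, h.2]

theorem chartEquivX_symm_chartU : (chartEquivX a b c).symm (chartU a b c) = awayCoord a b c 0 1 :=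
  (RingEquiv.symm_apply_eq _).mpr (chartEquivX_awayCoord_one a b c).symm

theorem chartEquivX_symm_chartV : (chartEquivX a b c).symm (chartV a b c) = awayCoord a b c 0 2 :=
  (RingEquiv.symm_apply_eq _).mpr (chartEquivX_awayCoord_two a b c).symm

theorem chartEquivY_symm_chartU : (chartEquivY a b c).symm (chartU a c b) = awayCoord a b c 1 0 :=
  (RingEquiv.symm_apply_eq _).mpr (chartEquivY_awayCoord_zero a b c).symm

theorem chartEquivY_symm_chartV : (chartEquivY a b c).symm (chartV a c b) = awayCoord a b c 1 2 :=
  (RingEquiv.symm_apply_eq _).mpr (chartEquivY_awayCoord_two a b c).symm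

theorem mul_eq_one_of_mul_eq {T : Type*} [CommRing T] {x y p q : T} (hx : IsUnit x)
    (h1 : p * x = y) (h2 : q * y = x) : p * q = 1 :=
  hx.mul_right_cancel (by linear_combination h2 + q * h1)

theorem eq_mul_of_mul_eq {T : Type*} [CommRing T] {x y z p r s : T} (hx : IsUnit x)
    (h1 : p * x = y) (h2 : r * x = z) (h3 : s * y = z) : r = s * p :=
  hx.mul_right_cancel (by linear_combination h2 - h3 - s * h1)

theorem overlapX_chartU_mul_overlapY_chartU :
    overlapX a b c (chartU a b c) * overlapY a b c (chartU a c b) = 1 := by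
  simp only [overlapX, overlapY, RingHom.comp_apply, RingHom.coe_coe, chartEquivX_symm_chartU,
    chartEquivY_symm_chartU]
  apply val_injective
  have h1 := val_awayMap_awayCoord a b c
    (rfl : quarticCoord a b c 0 * quarticCoord a b c 1 = _) 1
  have h2 := val_awayMap_awayCoord a b c
    (mul_comm _ _ : quarticCoord a b c 0 * quarticCoord a b c 1 = _) 0
  rw [val_mul, val_one]
  exact mul_eq_one_of_mul_eq (isUnit_quarticCoord_overlap a b c 0) h1 h2

theorem overlapX_chartV :
    overlapX a b c (chartV a b c) =
      overlapY a b c (chartV a c b) * overlapX a b c (chartU a b c) := by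
  simp only [overlapX, overlapY, RingHom.comp_apply, RingHom.coe_coe, chartEquivX_symm_chartU,
    chartEquivY_symm_chartV, chartEquivX_symm_chartV]
  apply val_injective
  have h1 := val_awayMap_awayCoord a b c
    (rfl : quarticCoord a b c 0 * quarticCoord a b c 1 = _) 1
  have h2 := val_awayMap_awayCoord a b c
    (rfl : quarticCoord a b c 0 * quarticCoord a b c 1 = _) 2
  have h3 := val_awayMap_awayCoord a b c
    (mul_comm _ _ : quarticCoord a b c 0 * quarticCoord a b c 1 = _) 2
  rw [val_mul]
  exact eq_mul_of_mul_eq (isUnit_quarticCoord_overlap a b c 0) h1 h2 h3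

end Charts

/-! ### Smoothness and singular points of the quartic -/

section Smooth

variable {R : Type u} [CommRing R] (a b c : R)

variable {a b c} in
theorem of_charts {P : MorphismProperty Scheme.{u}} [IsZariskiLocalAtSource P] {Y : Scheme.{u}}
    {f : planeQuartic a b c ⟶ Y} (hX : P (chartX a b c ≫ f)) (hY : P (chartY a b c ≫ f)) : P f := by
  rw [chartX, Category.assoc, P.cancel_left_of_respectsIso] at hX
  rw [chartY, Category.assoc, P.cancel_left_of_respectsIso] at hY
  refine IsZariskiLocalAtSource.of_openCover (quarticCover a b c).openCover fun i => ?_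
  change P (awayChart a b c (Fin.castSucc i) ≫ f)
  revert i
  exact Fin.forall_fin_two.mpr ⟨hX, hY⟩

theorem smoothOfRelativeDimension_planeQuarticToSpec [Nontrivial R] (h2 : IsUnit (2 : R))
    (ha : IsUnit (a ^ 2 - 1)) (hb : IsUnit (b ^ 2 - 1)) (hc : IsUnit (c ^ 2 - 1))
    (hd : IsUnit (symmDet a b c)) : SmoothOfRelativeDimension 1 (planeQuarticToSpec a b c) := by
  have hd' : IsUnit (symmDet a c b) := by
    convert hd using 1
    simp only [symmDet]; ring
  have hX : SmoothOfRelativeDimension 1 (chartX a b c ≫ planeQuarticToSpec a b c) := by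
    rw [chartX_comp_toSpec]
    exact HasRingHomProperty.Spec_iff.mpr
      (locally_isStandardSmoothOfRelativeDimension_chartRing h2 ha hb hd)
  have hY : SmoothOfRelativeDimension 1 (chartY a b c ≫ planeQuarticToSpec a b c) := by
    rw [chartY_comp_toSpec]
    exact HasRingHomProperty.Spec_iff.mpr
      (locally_isStandardSmoothOfRelativeDimension_chartRing h2 ha hc hd')
  have h : HasRingHomProperty (@SmoothOfRelativeDimension.{u} 1)
      (RingHom.Locally (RingHom.IsStandardSmoothOfRelativeDimension 1)) := inferInstance
  have := h.instIsZariskiLocalAtSource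
  exact of_charts (P := @SmoothOfRelativeDimension 1) hX hY

theorem formallySmooth_chartRing_of_smooth {X : Scheme.{u}} {f : X ⟶ Spec (.of R)} [Smooth f]
    (j : Spec (.of (ChartRing a b c)) ⟶ X) [IsOpenImmersion j]
    (h : j ≫ f = Spec.map (CommRingCat.ofHom (algebraMap R (ChartRing a b c)))) :
    Algebra.FormallySmooth R (ChartRing a b c) := by
  have : Smooth (j ≫ f) := inferInstance
  rw [h, HasRingHomProperty.Spec_iff (P := @Smooth)] at this
  have h' : (algebraMap R (ChartRing a b c)).Smooth := this
  rw [RingHom.smooth_algebraMap] at h'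
  infer_instance

/-- A row of the adjugate lies in the kernel of a singular symmetric matrix. The condition on `x, y`
places the resulting point in one of the two charts. -/
theorem exists_kernel_vector {K : Type*} [Field K] {a b c : K} (h : symmDet a b c = 0) :
    ∃ x y z : K, (x ≠ 0 ∨ y ≠ 0) ∧ x + a * y + b * z = 0 ∧ a * x + y + c * z = 0 ∧
      b * x + c * y + z = 0 := by
  by_cases hc : c ^ 2 = 1
  · by_cases hb : b = a * c
    · exact ⟨0, 1, -c, .inr one_ne_zero, by rw [hb]; linear_combination (-a) * hc,
        by linear_combination -hc, by ring⟩
    · refine ⟨0, 1, -c, .inr one_ne_zero, ?_, by linear_combination -hc, by ring⟩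
      -- When `c² = 1` the determinant condition degenerates to this square.
      have : (b - a * c) ^ 2 = 0 := by
        simp only [symmDet] at h
        linear_combination h + (a ^ 2 - 1) * hc
      exact (hb (sub_eq_zero.mp (pow_eq_zero_iff two_ne_zero |>.mp this))).elim
  · refine ⟨1 - c ^ 2, b * c - a, a * c - b, .inl fun h' => hc ?_, ?_, by ring, by ring⟩
    · linear_combination -h'
    · simp only [symmDet] at h
      linear_combination -h

theorem not_smooth_of_singular_point_chartX {K : Type u} [Field K] {a b c u v : K}
    (h : affineQuartic a b c u v = 0) (hu : u * (u ^ 2 + a + c * v ^ 2) = 0)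
    (hv : v * (v ^ 2 + b + c * u ^ 2) = 0) : ¬ Smooth (planeQuarticToSpec a b c) := fun _ =>
  not_formallySmooth_of_singular_point h hu hv
    (formallySmooth_chartRing_of_smooth a b c _ (chartX_comp_toSpec a b c))

theorem not_smooth_of_singular_point_chartY {K : Type u} [Field K] {a b c u v : K}
    (h : affineQuartic a c b u v = 0) (hu : u * (u ^ 2 + a + b * v ^ 2) = 0)
    (hv : v * (v ^ 2 + c + b * u ^ 2) = 0) : ¬ Smooth (planeQuarticToSpec a b c) := fun _ =>
  not_formallySmooth_of_singular_point h hu hv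
    (formallySmooth_chartRing_of_smooth a c b _ (chartY_comp_toSpec a b c))

/-- A singular point of the quartic with `x ≠ 0` or `y ≠ 0` prevents smoothness. -/
theorem not_smooth_of_singular_point {K : Type u} [Field K] {a b c x y z : K}
    (h0 : x ≠ 0 ∨ y ≠ 0) (hx : x * (x ^ 2 + a * y ^ 2 + b * z ^ 2) = 0)
    (hy : y * (a * x ^ 2 + y ^ 2 + c * z ^ 2) = 0)
    (hz : z * (b * x ^ 2 + c * y ^ 2 + z ^ 2) = 0) : ¬ Smooth (planeQuarticToSpec a b c) := by
  rcases h0 with h0 | h0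
  · refine not_smooth_of_singular_point_chartX (u := y / x) (v := z / x) ?_ ?_ ?_
    -- Euler's relation: the vanishing of the three partials puts the point on the curve.
    · simp only [affineQuartic]
      field_simp
      linear_combination x * hx + y * hy + z * hz
    · field_simp
      linear_combination hy
    · field_simp
      linear_combination hz
  · refine not_smooth_of_singular_point_chartY (u := x / y) (v := z / y) ?_ ?_ ?_
    · simp only [affineQuartic]
      field_simp
      linear_combination x * hx + y * hy + z * hz
    · field_simp
      linear_combination hx
    · field_simp
      linear_combination hz

theorem not_smooth_planeQuarticToSpec {K : Type u} [Field K] [IsAlgClosed K] {a b c : K}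
    (h : (a ^ 2 - 1) * (b ^ 2 - 1) * (c ^ 2 - 1) * symmDet a b c = 0) :
    ¬ Smooth (planeQuarticToSpec a b c) := by
  have hs (t : K) : ∃ s, s ^ 2 = t := by
    obtain ⟨s, hs⟩ := IsAlgClosed.exists_pow_nat_eq t two_pos
    exact ⟨s, hs⟩
  rcases mul_eq_zero.mp h with h | h
  · rcases mul_eq_zero.mp h with h | h
    · rcases mul_eq_zero.mp h with h | h
      -- If `a² = 1`, the vector `(1, -a)` spans the kernel of the 2×2 block of `a`, so `(1 : √(-a)
      -- : 0)` is singular. The cases of `b` and `c` are analogous.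
      · obtain ⟨s, hs⟩ := hs (-a)
        refine not_smooth_of_singular_point (x := 1) (y := s) (z := 0) (.inl one_ne_zero) ?_ ?_ ?_
        · rw [hs]; linear_combination -h
        · rw [hs]; ring
        · ring
      · obtain ⟨s, hs⟩ := hs (-b)
        refine not_smooth_of_singular_point (x := 1) (y := 0) (z := s) (.inl one_ne_zero) ?_ ?_ ?_
        · rw [hs]; linear_combination -h
        · ring
        · rw [hs]; ring
    · obtain ⟨s, hs⟩ := hs (-c)
      refine not_smooth_of_singular_point (x := 0) (y := 1) (z := s) (.inr one_ne_zero) ?_ ?_ ?_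
      · ring
      · rw [hs]; linear_combination -h
      · rw [hs]; ring
  -- The kernel vector consists of the squares of the coordinates of the singular point.
  · obtain ⟨x, y, z, h0, h1, h2, h3⟩ := exists_kernel_vector h
    obtain ⟨x, rfl⟩ := hs x
    obtain ⟨y, rfl⟩ := hs y
    obtain ⟨z, rfl⟩ := hs z
    refine not_smooth_of_singular_point (x := x) (y := y) (z := z) ?_ ?_ ?_ ?_
    · simpa using h0
    · rw [h1, mul_zero]
    · rw [h2, mul_zero]
    · rw [h3, mul_zero]

end Smooth

/-! ### Integrality of the quartic -/

section Integral

variable {R : Type u} [CommRing R] (a b c : R)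

theorem chartU_ne_zero [IsDomain R] : chartU a b c ≠ 0 := by
  have h := AdjoinRoot.of.injective_of_degree_ne_zero (f := chartPoly a b c) (by
    rw [Polynomial.degree_eq_natDegree (chartPoly_monic a b c).ne_zero, chartPoly_natDegree]
    decide)
  exact fun h0 => Polynomial.X_ne_zero (h (h0.trans (map_zero _).symm))

/-- The generic point of the first chart lies in the second, because `u = y / x` is not zero. -/
theorem not_disjoint_opensRange_chart [IsDomain R] [IsDomain (ChartRing a b c)] :
    ¬ Disjoint (chartX a b c).opensRange (chartY a b c).opensRange := by
  have : IsDomain (QuarticAway a b c 0) := (chartEquivX a b c).toMulEquiv.isDomain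
  let q : Spec (.of (QuarticAway a b c 0)) := (⊥ : PrimeSpectrum (QuarticAway a b c 0))
  have hq : q ∈ awayChart a b c 0 ⁻¹ᵁ
      Proj.basicOpen (quarticGrading a b c) (quarticCoord a b c 1) := by
    have h1 := Proj.awayι_preimage_basicOpen (quarticGrading a b c) (quarticCoord_mem a b c 0)
      one_pos (quarticCoord_mem a b c 1) one_pos
    refine (Iff.of_eq congr(q ∈ $h1)).mpr ?_
    have h2 : HomogeneousLocalization.Away.isLocalizationElem (quarticCoord_mem a b c 0)
        (quarticCoord_mem a b c 1) = awayCoord a b c 0 1 := by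
      simp [HomogeneousLocalization.Away.isLocalizationElem, awayCoord]
    change HomogeneousLocalization.Away.isLocalizationElem (quarticCoord_mem a b c 0)
        (quarticCoord_mem a b c 1) ∉ (⊥ : Ideal (QuarticAway a b c 0))
    rw [h2, Ideal.mem_bot, ← chartEquivX_symm_chartU, map_eq_zero_iff _ (RingEquiv.injective _)]
    exact chartU_ne_zero a b c
  rw [opensRange_chartX, opensRange_chartY]
  intro h
  have hX : awayChart a b c 0 q ∈ Proj.basicOpen (quarticGrading a b c) (quarticCoord a b c 0) := by
    rw [← opensRange_awayChart]
    exact ⟨q, rfl⟩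
  exact h.le_bot ⟨hX, hq⟩

variable {K : Type u} [Field K]

/-- Two irreducible open charts that meet have an irreducible union, and reducedness is local. -/
theorem isIntegral_planeQuartic (h2 : (2 : K) ≠ 0) {a b c : K} (ha : a ^ 2 - 1 ≠ 0)
    (hb : b ^ 2 - 1 ≠ 0) (hc : c ^ 2 - 1 ≠ 0) (hd : symmDet a b c ≠ 0) :
    AlgebraicGeometry.IsIntegral (planeQuartic a b c) := by
  have hd' : symmDet a c b ≠ 0 := by
    convert hd using 1
    simp only [symmDet]; ring
  have hX : IsDomain (ChartRing a b c) := isDomain_chartRing h2 ha hb hc hd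
  have hY : IsDomain (ChartRing a c b) := isDomain_chartRing h2 ha hc hb hd'
  have hX' : AlgebraicGeometry.IsIntegral (Spec (.of (ChartRing a b c))) := inferInstance
  have hY' : AlgebraicGeometry.IsIntegral (Spec (.of (ChartRing a c b))) := inferInstance
  have hred : AlgebraicGeometry.IsReduced (planeQuartic a b c) := by
    have (i : Fin 2) : AlgebraicGeometry.IsReduced ((quarticCover a b c).openCover.X i) := by
      change AlgebraicGeometry.IsReduced (Spec (.of (QuarticAway a b c (Fin.castSucc i))))
      revert i
      refine Fin.forall_fin_two.mpr ⟨?_, ?_⟩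
      · exact isReduced_of_isOpenImmersion
          (Spec.map (chartEquivX a b c).symm.toCommRingCatIso.hom)
      · exact isReduced_of_isOpenImmersion
          (Spec.map (chartEquivY a b c).symm.toCommRingCatIso.hom)
    exact @IsReduced.of_openCover _ (quarticCover a b c).openCover this
  have himg {A : Type u} [CommRing A] [IsDomain A] (j : Spec (.of A) ⟶ planeQuartic a b c)
      [IsOpenImmersion j] : IsPreirreducible (j.opensRange : Set (planeQuartic a b c)) := by
    have := (PreirreducibleSpace.isPreirreducible_univ (X := Spec (.of A))).image j
      j.continuous.continuousOn
    rwa [Set.image_univ] at this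
  have hdis := not_disjoint_opensRange_chart a b c
  have hpre : PreirreducibleSpace (planeQuartic a b c) := ⟨by
    refine IsPreirreducible.of_subset_iUnion
      (U := ![(chartX a b c).opensRange, (chartY a b c).opensRange]) ?_ ?_ isOpen_univ ?_
    · intro i j hij
      fin_cases i <;> fin_cases j <;> first | exact (hij rfl).elim | skip
      · exact hdis
      · exact fun h => hdis h.symm
    · exact Fin.forall_fin_two.mpr ⟨himg _, himg _⟩
    · intro p _
      rw [Set.mem_iUnion, Fin.exists_fin_two]
      exact mem_opensRange_chart a b c p⟩
  have : IrreducibleSpace (planeQuartic a b c) :=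
    { hpre with toNonempty := ⟨chartX a b c (⊥ : PrimeSpectrum (ChartRing a b c))⟩ }
  exact isIntegral_of_irreducibleSpace_of_isReduced _

end Integral

/-! ### Projectivity -/

/-- The image of the functions on `Y` is a subring containing the images of `B` and `C`, so it is
everything. Applied to a fibre product, this avoids writing its ring as a tensor product. -/
theorem isClosedImmersion_of_subring_eq_top {A B C : CommRingCat.{u}} {Y : Scheme.{u}} [IsAffine Y]
    {h : Spec A ⟶ Y} {p : Y ⟶ Spec B} {q : Y ⟶ Spec C} {φ : B ⟶ A} {ψ : C ⟶ A}
    (hp : h ≫ p = Spec.map φ) (hq : h ≫ q = Spec.map ψ)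
    (hgen : ∀ s : Subring A, (∀ b, φ.hom b ∈ s) → (∀ c, ψ.hom c ∈ s) → s = ⊤) :
    IsClosedImmersion h := by
  have key {D : CommRingCat.{u}} {r : Y ⟶ Spec D} {χ : D ⟶ A} (hr : h ≫ r = Spec.map χ) (d : D) :
      χ.hom d ∈ (h.appTop ≫ (Scheme.ΓSpecIso A).hom).hom.range := by
    refine ⟨((Scheme.ΓSpecIso D).inv ≫ r.appTop).hom d, ?_⟩
    have h1 : ((Scheme.ΓSpecIso D).inv ≫ r.appTop) ≫ h.appTop ≫ (Scheme.ΓSpecIso A).hom = χ := by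
      rw [Category.assoc, ← Scheme.Hom.comp_appTop_assoc, hr, Scheme.ΓSpecIso_naturality,
        Iso.inv_hom_id_assoc]
    exact congr($(h1).hom d)
  have htop := hgen _ (key hp) (key hq)
  refine IsClosedImmersion.of_surjective_of_isAffine _ fun x => ?_
  obtain ⟨y, hy⟩ : (Scheme.ΓSpecIso A).hom.hom x ∈
      (h.appTop ≫ (Scheme.ΓSpecIso A).hom).hom.range := by
    rw [htop]; trivial
  exact ⟨y, (Scheme.ΓSpecIso A).commRingCatIsoToRingEquiv.injective hy⟩

/-- Closed immersions are local on the target, and a cover of `W` induces one of the fibre product.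
By `hq` the part of `X` over the `i`-th member is `V i`. -/
theorem isClosedImmersion_lift_of_cover {X S W T : Scheme.{u}} {p : X ⟶ S} {q : X ⟶ W} {s : S ⟶ T}
    {w : W ⟶ T} (hpq : p ≫ s = q ≫ w) (𝒱 : W.OpenCover) {V : 𝒱.I₀ → Scheme.{u}}
    (h : ∀ i, V i ⟶ pullback s (𝒱.f i ≫ w)) (j : ∀ i, V i ⟶ X)
    (hh : ∀ i, IsClosedImmersion (h i))
    (hp : ∀ i, h i ≫ pullback.fst _ _ = j i ≫ p)
    (hq : ∀ i, IsPullback (h i ≫ pullback.snd _ _) (j i) (𝒱.f i) q) :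
    IsClosedImmersion (pullback.lift p q hpq) := by
  let M (i : 𝒱.I₀) : pullback s (𝒱.f i ≫ w) ⟶ pullback s w :=
    pullback.map _ _ _ _ (𝟙 _) (𝒱.f i) (𝟙 _) (by simp) (by simp)
  suffices H : ∀ i : 𝒱.I₀, IsClosedImmersion (pullback.snd (pullback.lift p q hpq) (M i)) from
    IsZariskiLocalAtTarget.of_openCover (Scheme.Pullback.openCoverOfRight 𝒱 s w) H
  intro i
  let m := M i
  have hm1 : m ≫ pullback.fst _ _ = pullback.fst _ _ :=
    (pullback.lift_fst _ _ _).trans (Category.comp_id _)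
  have hm2 : m ≫ pullback.snd _ _ = pullback.snd _ _ ≫ 𝒱.f i := pullback.lift_snd _ _ _
  have hY : IsPullback (pullback.snd _ _) m (𝒱.f i) (pullback.snd s w) := by
    refine IsPullback.of_bot (v₂₁ := pullback.fst _ _) (v₂₂ := w) (h₃₁ := s) ?_ hm2.symm
      (IsPullback.of_hasPullback _ _).flip
    rw [hm1]
    exact (IsPullback.of_hasPullback _ _).flip
  have hpb : IsPullback (h i) (j i) m (pullback.lift p q hpq) := by
    refine IsPullback.of_right (h₁₂ := pullback.snd _ _) (h₂₂ := pullback.snd _ _)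
      (v₁₃ := 𝒱.f i) ?_ ?_ hY
    · rw [pullback.lift_snd]
      exact hq i
    · refine pullback.hom_ext ?_ ?_
      · rw [Category.assoc, Category.assoc, hm1, pullback.lift_fst, hp]
      · rw [Category.assoc, Category.assoc, hm2, pullback.lift_snd, ← Category.assoc, (hq i).w]
  change IsClosedImmersion (pullback.snd (pullback.lift p q hpq) m)
  rw [← MorphismProperty.cancel_left_of_respectsIso @IsClosedImmersion hpb.flip.isoPullback.hom,
    hpb.flip.isoPullback_hom_snd]
  exact hh i

section

open HomogeneousLocalization HomogeneousIdeal

variable {R : Type} [CommRing R] (a b c : R)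

/-- The homomorphism `ℤ[x, y, z] → R[x, y, z] ⧸ (F)` of graded rings. -/
def integralCoordMap :
    MvPolynomial.homogeneousSubmodule (Fin 3) ℤ →+*ᵍ quarticGrading a b c where
  __ := (Ideal.Quotient.mk (Ideal.span {quarticForm a b c})).comp
    (MvPolynomial.map (Int.castRingHom R))
  map_mem {_ _} hP := mk_mem_quarticGrading _ _ _ (MvPolynomial.IsHomogeneous.map hP _)

theorem integralCoordMap_X (i : Fin 3) :
    integralCoordMap a b c (.X i) = quarticCoord a b c i :=
  congr_arg (Ideal.Quotient.mk _) (MvPolynomial.map_X _ i)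

theorem irrelevant_le_map_integralCoordMap : (quarticGrading a b c)₊ ≤
    (MvPolynomial.homogeneousSubmodule (Fin 3) ℤ)₊.map (integralCoordMap a b c) :=
  irrelevant_le_map_of_quarticCoord _ _ _ _ MvPolynomial.X (MvPolynomial.isHomogeneous_X ℤ)
    (integralCoordMap_X a b c)

/-- The embedding of the quartic, followed by the projection to the projective plane over `ℤ`. -/
def toIntegralPlane : planeQuartic a b c ⟶ Proj (MvPolynomial.homogeneousSubmodule (Fin 3) ℤ) :=
  Proj.map (integralCoordMap a b c) (irrelevant_le_map_integralCoordMap a b c)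

theorem irrelevant_le_span_X : (MvPolynomial.homogeneousSubmodule (Fin 3) ℤ)₊.toIdeal ≤
    Ideal.span (Set.range (MvPolynomial.X : Fin 3 → MvPolynomial (Fin 3) ℤ)) := by
  rw [HomogeneousIdeal.toIdeal_irrelevant_le]
  intro n hn P hP
  change P ∈ Ideal.span _
  rw [← Set.image_univ, MvPolynomial.mem_ideal_span_X_image]
  intro d hd
  have := hP (MvPolynomial.mem_support_iff.mp hd)
  by_contra! h
  rw [show d = 0 from Finsupp.ext fun i => h i (Set.mem_univ i), map_zero] at this
  omega

/-- The standard affine cover of the projective plane over `ℤ`. -/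
def planeCover : (Proj (MvPolynomial.homogeneousSubmodule (Fin 3) ℤ)).AffineOpenCover :=
  Proj.affineOpenCoverOfIrrelevantLESpan _ MvPolynomial.X (MvPolynomial.isHomogeneous_X ℤ)
    (fun _ => one_pos) irrelevant_le_span_X

/-- The embedding of the quartic into the projective plane. -/
def toProjectivePlane : planeQuartic a b c ⟶ projectiveSpace 2 (Spec (.of R)) :=
  pullback.lift (planeQuarticToSpec a b c) (toIntegralPlane a b c) (terminal.hom_ext _ _)

theorem toProjectivePlane_comp :
    toProjectivePlane a b c ≫ projectiveSpaceToBase 2 (Spec (.of R)) = planeQuarticToSpec a b c :=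
  pullback.lift_fst _ _ _

instance isClosedImmersion_toProjectivePlane : IsClosedImmersion (toProjectivePlane a b c) := by
  let S := Spec (.of R)
  let W := Proj (MvPolynomial.homogeneousSubmodule (Fin 3) ℤ)
  have H (i : Fin 3) := exists_awayMap_of_eq (integralCoordMap a b c)
    (irrelevant_le_map_integralCoordMap a b c) (MvPolynomial.isHomogeneous_X ℤ i)
    (quarticCoord_mem a b c i) (integralCoordMap_X a b c i)
  choose ψ hψ hP using H
  -- The coordinate ratios come from the plane over `ℤ` and the constants from `R`; together they
  -- generate the functions on the chart.
  have hcoord (i j : Fin 3) : ∃ y, ψ i y = awayCoord a b c i j := by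
    have hX : (.X j : MvPolynomial (Fin 3) ℤ) ∈
        MvPolynomial.homogeneousSubmodule (Fin 3) ℤ (1 • 1) := MvPolynomial.isHomogeneous_X ℤ j
    have h3 := hψ i 1 (.X j) hX ((integralCoordMap_X a b c j).symm ▸ quarticCoord_mem a b c j)
    simp only [integralCoordMap_X] at h3
    exact ⟨_, h3⟩
  let h (i : Fin 3) : Spec (.of (QuarticAway a b c i)) ⟶
      pullback (terminal.from S) (planeCover.openCover.f i ≫ terminal.from W) :=
    pullback.lift (Spec.map (CommRingCat.ofHom (awayC a b c i)))
      (Spec.map (CommRingCat.ofHom (ψ i))) (terminal.hom_ext _ _)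
  have hfst (i : Fin 3) : h i ≫ pullback.fst _ _ = Spec.map (CommRingCat.ofHom (awayC a b c i)) :=
    pullback.lift_fst _ _ _
  have hsnd (i : Fin 3) : h i ≫ pullback.snd _ _ = Spec.map (CommRingCat.ofHom (ψ i)) :=
    pullback.lift_snd _ _ _
  refine isClosedImmersion_lift_of_cover _ planeCover.openCover h (awayChart a b c) ?_ ?_ ?_
  · intro i
    have : IsAffine (planeCover.openCover.X i) :=
      inferInstanceAs (IsAffine (Spec (.of (Away _ _))))
    refine isClosedImmersion_of_subring_eq_top (hfst i) (hsnd i) fun s h1 h2 => ?_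
    refine eq_top_iff.mpr fun x _ => ?_
    obtain ⟨P, rfl⟩ := eval₂_awayCoord_surjective a b c i x
    have (P : MvPolynomial (Fin 3) R) : P.eval₂ (awayC a b c i) (awayCoord a b c i) ∈ s := by
      induction P using MvPolynomial.induction_on with
      | C r => rw [MvPolynomial.eval₂_C]; exact h1 r
      | add p q hp hq => rw [MvPolynomial.eval₂_add]; exact s.add_mem hp hq
      | mul_X p j hp =>
        rw [MvPolynomial.eval₂_mul, MvPolynomial.eval₂_X]
        obtain ⟨y, hy⟩ := hcoord i j
        exact s.mul_mem hp (hy ▸ h2 y)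
    exact this P
  · exact fun i => (hfst i).trans (awayChart_comp_toSpec a b c i).symm
  · intro i
    have e := congr(IsPullback $(hsnd i) (awayChart a b c i) (planeCover.openCover.f i)
      (toIntegralPlane a b c))
    exact e.mpr (hP i)

theorem isProjectiveMorphism_planeQuarticToSpec :
    IsProjectiveMorphism (planeQuarticToSpec a b c) :=
  ⟨2, toProjectivePlane a b c, inferInstance, toProjectivePlane_comp a b c⟩

end

theorem isPullback_map_fst {S S' P T : Scheme.{u}} {s : S ⟶ T} {s' : S' ⟶ T} {w : P ⟶ T}
    {g : S' ⟶ S} (h : s' ≫ 𝟙 T = g ≫ s) (h' : w ≫ 𝟙 T = 𝟙 P ≫ w) :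
    IsPullback (pullback.map s' w s w g (𝟙 P) (𝟙 T) h h') (pullback.fst s' w)
      (pullback.fst s w) g := by
  rw [Category.comp_id] at h
  refine IsPullback.of_right (h₁₂ := pullback.snd _ _) (h₂₂ := s) (v₁₃ := w) ?_
    (pullback.lift_fst _ _ _) (IsPullback.of_hasPullback _ _).flip
  have h1 : pullback.map s' w s w g (𝟙 P) (𝟙 T) ((Category.comp_id _).trans h) h' ≫
      pullback.snd _ _ = pullback.snd _ _ := (pullback.lift_snd _ _ _).trans (Category.comp_id _)
  rw [h1, ← h]
  exact (IsPullback.of_hasPullback _ _).flip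

/-- Projective space commutes with base change, and closed immersions are stable under it. -/
theorem IsProjectiveMorphism.of_isPullback {X S X' S' : Scheme.{0}} {f : X ⟶ S} {f' : X' ⟶ S'}
    {g' : X' ⟶ X} {g : S' ⟶ S} (h : IsPullback g' f' f g) (hf : IsProjectiveMorphism f) :
    IsProjectiveMorphism f' := by
  obtain ⟨n, i, hi, rfl⟩ := hf
  let P := Proj (MvPolynomial.homogeneousSubmodule (Fin (n + 1)) ℤ)
  let p : projectiveSpace n S' ⟶ projectiveSpace n S :=
    pullback.map _ _ _ _ g (𝟙 P) (𝟙 _) (terminal.hom_ext _ _) (terminal.hom_ext _ _)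
  have hp : IsPullback p (projectiveSpaceToBase n S') (projectiveSpaceToBase n S) g :=
    isPullback_map_fst _ _
  let i' : X' ⟶ projectiveSpace n S' := hp.lift (g' ≫ i) f' (by simpa using h.w)
  have hi' : IsPullback g' i' i p := by
    refine IsPullback.of_bot ?_ (hp.lift_fst _ _ _).symm hp
    rwa [hp.lift_snd]
  exact ⟨n, i', MorphismProperty.of_isPullback hi' hi, hp.lift_snd _ _ _⟩

/-! ### Functoriality of differentials -/

section KaehlerMap

open KaehlerDifferential

variable {k A B C : Type*} [CommRing k] [CommRing A] [CommRing B] [CommRing C] [Algebra k A]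
  [Algebra k B] [Algebra k C] (φ : A →ₐ[k] B) (ψ : B →ₐ[k] C)

@[simp]
theorem kaehlerMap_D (x : A) : kaehlerMap φ (D k A x) = D k B (φ x) := by
  let := φ.toRingHom.toAlgebra
  have : IsScalarTower k A B := .of_algebraMap_eq fun r => (φ.commutes r).symm
  exact KaehlerDifferential.map_D k k A B x

@[simp]
theorem kaehlerMap_smul (x : A) (ω : Ω[A⁄k]) :
    kaehlerMap φ (x • ω) = φ x • kaehlerMap φ ω := by
  let := φ.toRingHom.toAlgebra
  have : IsScalarTower k A B := .of_algebraMap_eq fun r => (φ.commutes r).symm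
  exact ((KaehlerDifferential.map k k A B).map_smul x ω).trans (algebraMap_smul B x _)

theorem kaehler_induction {p : Ω[A⁄k] → Prop} (ω : Ω[A⁄k]) (h : ∀ a b : A, p (a • D k A b))
    (hadd : ∀ x y, p x → p y → p (x + y)) : p ω := by
  have : ω ∈ Submodule.span A (Set.range (D k A)) := by
    rw [KaehlerDifferential.span_range_derivation]; trivial
  refine Submodule.closure_induction (p := fun x _ => p x) ?_ ?_ ?_ this
  · simpa using h 0 0
  · intro x y _ _; exact hadd x y
  · rintro a _ ⟨b, rfl⟩; exact h a b

theorem kaehlerMap_comp (ω : Ω[A⁄k]) :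
    kaehlerMap (ψ.comp φ) ω = kaehlerMap ψ (kaehlerMap φ ω) := by
  induction ω using kaehler_induction with
  | h a b => simp
  | hadd x y hx hy => simp [hx, hy]

theorem kaehlerMap_surjective (e : A ≃ₐ[k] B) :
    Function.Surjective (kaehlerMap (e : A →ₐ[k] B)) := by
  intro ω
  refine ⟨kaehlerMap (e.symm : B →ₐ[k] A) ω, ?_⟩
  rw [← kaehlerMap_comp]
  induction ω using kaehler_induction with
  | h a b => simp
  | hadd x y hx hy => rw [map_add, hx, hy]

end KaehlerMap

/-! ### Differentials on the charts -/

section ChartDifferentials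

open KaehlerDifferential Polynomial

variable {K : Type*} [Field K] (a b c : K)

theorem exists_coeff_chartRing (x : ChartRing a b c) : ∃ p : ℕ → K[X],
    x = ∑ i ∈ Finset.range 4, AdjoinRoot.of _ (p i) * chartV a b c ^ i := by
  obtain ⟨P, rfl⟩ := AdjoinRoot.mk_surjective x
  refine ⟨fun i => (P %ₘ chartPoly a b c).coeff i, ?_⟩
  have h1 : AdjoinRoot.mk (chartPoly a b c) P = AdjoinRoot.mk _ (P %ₘ chartPoly a b c) := by
    rw [AdjoinRoot.mk_eq_mk]
    exact ⟨P /ₘ chartPoly a b c, by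
      linear_combination -(Polynomial.modByMonic_add_div P (chartPoly a b c))⟩
  have hlt : (P %ₘ chartPoly a b c).natDegree < 4 := by
    have := Polynomial.natDegree_modByMonic_lt P (chartPoly_monic a b c) (fun h => by
      have := chartPoly_natDegree a b c
      rw [h, natDegree_one] at this
      omega)
    rwa [chartPoly_natDegree] at this
  rw [h1]
  conv_lhs => rw [(P %ₘ chartPoly a b c).as_sum_range' 4 hlt]
  rw [map_sum]
  refine Finset.sum_congr rfl fun i _ => ?_
  rw [← C_mul_X_pow_eq_monomial, map_mul, map_pow]
  rfl

/-- The powers `1, v, v², v³` are independent over `K[u]`, since `chartPoly` is monic of degree 4 in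
`v`. -/
theorem coeff_eq_zero_of_sum_eq_zero {p : ℕ → K[X]}
    (h : ∑ i ∈ Finset.range 4, AdjoinRoot.of (chartPoly a b c) (p i) * chartV a b c ^ i = 0)
    {i : ℕ} (hi : i < 4) : p i = 0 := by
  set P : K[X][X] := ∑ i ∈ Finset.range 4, Polynomial.C (p i) * Polynomial.X ^ i with hP
  have h1 : AdjoinRoot.mk (chartPoly a b c) P = 0 := by
    rw [hP, map_sum, ← h]
    refine Finset.sum_congr rfl fun i _ => ?_
    rw [map_mul, map_pow]
    rfl
  have hdeg : P.degree < (chartPoly a b c).degree := by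
    rw [Polynomial.degree_eq_natDegree (chartPoly_monic a b c).ne_zero, chartPoly_natDegree]
    refine (Polynomial.degree_sum_le _ _).trans_lt ((Finset.sup_lt_iff ?_).mpr fun j hj => ?_)
    · exact WithBot.bot_lt_coe _
    · exact (Polynomial.degree_C_mul_X_pow_le _ _).trans_lt (by
        exact_mod_cast Finset.mem_range.mp hj)
  have h0 : P = 0 := by
    by_contra hne
    exact (chartPoly_monic a b c).not_dvd_of_degree_lt hne hdeg (AdjoinRoot.mk_eq_zero.mp h1)
  have := congr(Polynomial.coeff $h0 i)
  rw [hP, Polynomial.finsetSum_coeff, coeff_zero, Finset.sum_eq_single i] at this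
  · simpa using this
  · intro j _ hj
    rw [coeff_C_mul_X_pow, if_neg hj.symm]
  · intro hi'
    exact (hi' (Finset.mem_range.mpr hi)).elim

theorem D_relation_chart (h2 : (2 : K) ≠ 0) :
    chartDu a b c • D K (ChartRing a b c) (chartU a b c) +
      chartDv a b c • D K (ChartRing a b c) (chartV a b c) = 0 := by
  have h := congr(D K (ChartRing a b c) $(chartRing_relation a b c))
  have h4 : algebraMap K (ChartRing a b c) 4 •
      (chartDu a b c • D K (ChartRing a b c) (chartU a b c) +
      chartDv a b c • D K (ChartRing a b c) (chartV a b c)) = 0 := by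
    rw [map_zero] at h
    rw [← h]
    have h2' : D K (ChartRing a b c) 2 = 0 := by
      rw [← map_ofNat (algebraMap K (ChartRing a b c)) 2, Derivation.map_algebraMap]
    simp only [affineQuartic, map_add, Derivation.leibniz, Derivation.leibniz_pow,
      Derivation.map_algebraMap, h2', Derivation.map_one_eq_zero, chartDu, chartDv, map_ofNat]
    module
  have hu : IsUnit (algebraMap K (ChartRing a b c) 4) := by
    refine (IsUnit.mk0 _ ?_).map _
    rw [show (4 : K) = 2 * 2 by norm_num]
    exact mul_ne_zero h2 h2
  exact (hu.smul_eq_zero).mp h4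

/-- The first-order change of `F` along the Hamiltonian field `(F_v, -F_u)` is `F_u F_v - F_v F_u =
0`. -/
theorem affineQuartic_dual : affineQuartic
    (TrivSqZeroExt.inlHom (ChartRing a b c) (ChartRing a b c) (algebraMap K _ a))
    (TrivSqZeroExt.inlHom (ChartRing a b c) (ChartRing a b c) (algebraMap K _ b))
    (TrivSqZeroExt.inlHom (ChartRing a b c) (ChartRing a b c) (algebraMap K _ c))
    (TrivSqZeroExt.inl (chartU a b c) + TrivSqZeroExt.inr (chartDv a b c))
    (TrivSqZeroExt.inl (chartV a b c) - TrivSqZeroExt.inr (chartDu a b c)) = 0 := by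
  have hrel := chartRing_relation a b c
  have h2 : (2 : TrivSqZeroExt (ChartRing a b c) (ChartRing a b c)) = TrivSqZeroExt.inl 2 := by
    rw [← one_add_one_eq_two, ← one_add_one_eq_two, TrivSqZeroExt.inl_add, TrivSqZeroExt.inl_one]
  simp only [affineQuartic] at hrel
  ext
  · simpa [affineQuartic, h2] using hrel
  · simp [affineQuartic, chartDu, chartDv, pow_succ, h2]
    ring

/-- The infinitesimal automorphism `u ↦ u + ε F_v / 4`, `v ↦ v - ε F_u / 4` of the chart ring. -/
def chartFlow : ChartRing a b c →+* TrivSqZeroExt (ChartRing a b c) (ChartRing a b c) :=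
  chartLift ((TrivSqZeroExt.inlHom (ChartRing a b c) (ChartRing a b c)).comp
    (algebraMap K (ChartRing a b c))) _ _ (affineQuartic_dual a b c)

theorem fst_chartFlow (x : ChartRing a b c) : (chartFlow a b c x).fst = x := by
  have : (TrivSqZeroExt.fstHom K (ChartRing a b c) (ChartRing a b c)).toRingHom.comp
      (chartFlow a b c) = RingHom.id _ :=
    chartRing_hom_ext (by simp [chartFlow]) (by simp [chartFlow]) (by simp [chartFlow])
  exact congr($this x)

/-- The derivation `u ↦ F_v / 4`, `v ↦ -F_u / 4` of the chart ring. -/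
def chartDerivation : Derivation K (ChartRing a b c) (ChartRing a b c) where
  toFun x := (chartFlow a b c x).snd
  map_add' x y := by simp
  map_smul' r x := by
    rw [Algebra.smul_def, map_mul, TrivSqZeroExt.snd_mul]
    simp [chartFlow, Algebra.smul_def]
  map_one_eq_zero' := by simp
  leibniz' x y := by
    simp [fst_chartFlow, mul_comm]

theorem chartDerivation_chartU : chartDerivation a b c (chartU a b c) = chartDv a b c := by
  change (chartFlow a b c _).snd = _
  simp [chartFlow]

theorem chartDerivation_chartV : chartDerivation a b c (chartV a b c) = -chartDu a b c := by
  change (chartFlow a b c _).snd = _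
  simp [chartFlow]

theorem chartRing_induction {p : ChartRing a b c → Prop} (hC : ∀ r : K, p (algebraMap K _ r))
    (hU : p (chartU a b c)) (hV : p (chartV a b c)) (hadd : ∀ x y, p x → p y → p (x + y))
    (hmul : ∀ x y, p x → p y → p (x * y)) (x : ChartRing a b c) : p x := by
  have hpow {y} (hy : p y) (n : ℕ) : p (y ^ n) := by
    induction n with
    | zero => simpa using hC 1
    | succ n ih => rw [pow_succ]; exact hmul _ _ ih hy
  have hof (q : K[X]) : p (AdjoinRoot.of _ q) := by
    induction q using Polynomial.induction_on' with
    | add q r hq hr => rw [map_add]; exact hadd _ _ hq hr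
    | monomial n r =>
      rw [← C_mul_X_pow_eq_monomial, map_mul, map_pow]
      exact hmul _ _ (hC r) (hpow hU n)
  obtain ⟨q, rfl⟩ := exists_coeff_chartRing a b c x
  refine Finset.sum_induction _ p hadd (by simpa using hC 0) fun i _ => ?_
  exact hmul _ _ (hof _) (hpow hV i)

/-- The differential `β du - α dv`, which generates the differentials when `α F_u + β F_v = 4`. -/
def chartForm (α β : ChartRing a b c) : Ω[ChartRing a b c⁄K] :=
  β • D K _ (chartU a b c) - α • D K _ (chartV a b c)

variable {a b c} {α β : ChartRing a b c}

section

variable (h2 : (2 : K) ≠ 0) (h : α * chartDu a b c + β * chartDv a b c = 1)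
include h2 h

/-- Multiply `du` by `1 = α F_u + β F_v` (partials divided by 4) and replace `F_u du` by `-F_v dv`.
-/
theorem D_chartU : D K _ (chartU a b c) = chartDv a b c • chartForm a b c α β := by
  have hr := D_relation_chart a b c h2
  have : D K _ (chartU a b c) - chartDv a b c • chartForm a b c α β =
      α • (chartDu a b c • D K (ChartRing a b c) (chartU a b c) +
      chartDv a b c • D K (ChartRing a b c) (chartV a b c)) -
      (α * chartDu a b c + β * chartDv a b c - 1) • D K _ (chartU a b c) := by
    rw [chartForm]; module
  rw [hr, h, sub_self, zero_smul, smul_zero, sub_zero] at this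
  exact sub_eq_zero.mp this

theorem D_chartV : D K _ (chartV a b c) = -chartDu a b c • chartForm a b c α β := by
  have hr := D_relation_chart a b c h2
  have : D K _ (chartV a b c) - -chartDu a b c • chartForm a b c α β =
      β • (chartDu a b c • D K (ChartRing a b c) (chartU a b c) +
      chartDv a b c • D K (ChartRing a b c) (chartV a b c)) -
      (α * chartDu a b c + β * chartDv a b c - 1) • D K _ (chartV a b c) := by
    rw [chartForm]; module
  rw [hr, h, sub_self, zero_smul, smul_zero, sub_zero] at this
  exact sub_eq_zero.mp this

theorem exists_eq_smul_chartForm (ω : Ω[ChartRing a b c⁄K]) :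
    ∃ x : ChartRing a b c, ω = x • chartForm a b c α β := by
  induction ω using kaehler_induction with
  | h s t =>
    suffices H : ∃ x : ChartRing a b c, D K _ t = x • chartForm a b c α β by
      obtain ⟨x, hx⟩ := H
      exact ⟨s * x, by rw [hx, mul_smul]⟩
    induction t using chartRing_induction with
    | hC r => exact ⟨0, by rw [Derivation.map_algebraMap, zero_smul]⟩
    | hU => exact ⟨_, D_chartU h2 h⟩
    | hV => exact ⟨_, D_chartV h2 h⟩
    | hadd x y hx hy =>
      obtain ⟨x', hx⟩ := hx
      obtain ⟨y', hy⟩ := hy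
      exact ⟨x' + y', by rw [map_add, hx, hy, add_smul]⟩
    | hmul x y hx hy =>
      obtain ⟨x', hx⟩ := hx
      obtain ⟨y', hy⟩ := hy
      exact ⟨x * y' + y * x', by rw [Derivation.leibniz, hx, hy]; module⟩
  | hadd x y hx hy =>
    obtain ⟨x', hx⟩ := hx
    obtain ⟨y', hy⟩ := hy
    exact ⟨x' + y', by rw [hx, hy, add_smul]⟩

end

/-- The Hamiltonian derivation takes the value `β F_v + α F_u = 1` on the form, again with partials
divided by 4. -/
theorem chartForm_ne_zero [Nontrivial (ChartRing a b c)]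
    (h : α * chartDu a b c + β * chartDv a b c = 1) : chartForm a b c α β ≠ 0 := by
  intro h0
  have := congr((chartDerivation a b c).liftKaehlerDifferential $h0)
  rw [chartForm, map_sub, map_smul, map_smul, Derivation.liftKaehlerDifferential_comp_D,
    Derivation.liftKaehlerDifferential_comp_D, chartDerivation_chartU, chartDerivation_chartV,
    map_zero, smul_eq_mul, smul_eq_mul] at this
  exact one_ne_zero (h.symm.trans (by linear_combination this))

end ChartDifferentials

/-! ### Forms that are regular on both charts -/

section Regular

open KaehlerDifferential Polynomial

variable {K L : Type*} [Field K] [Field L] [Algebra K L] {a b c : K}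
  {χ₀ : ChartRing a b c →ₐ[K] L} {χ₁ : ChartRing a c b →ₐ[K] L}

theorem chartHom_of (χ : ChartRing a b c →ₐ[K] L) (p : K[X]) :
    χ (AdjoinRoot.of _ p) = p.eval₂ (algebraMap K L) (χ (chartU a b c)) := by
  have : (χ : ChartRing a b c →+* L).comp (AdjoinRoot.of _) =
      Polynomial.eval₂RingHom (algebraMap K L) (χ (chartU a b c)) := by
    refine Polynomial.ringHom_ext (fun r => ?_) ?_
    · rw [coe_eval₂RingHom, eval₂_C]
      exact χ.commutes r
    · rw [coe_eval₂RingHom, eval₂_X]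
      rfl
  exact congr($this p)

theorem chartHom_relation (χ : ChartRing a b c →ₐ[K] L) :
    affineQuartic (algebraMap K L a) (algebraMap K L b) (algebraMap K L c) (χ (chartU a b c))
      (χ (chartV a b c)) = 0 := by
  have := congr(χ $(chartRing_relation a b c))
  have h2 : χ 2 = 2 := map_ofNat χ 2
  simpa [affineQuartic, h2] using this

section Coeff

variable (h₀ : Function.Injective χ₀) (hu : χ₀ (chartU a b c) * χ₁ (chartU a c b) = 1)
  (hv : χ₀ (chartV a b c) = χ₁ (chartV a c b) * χ₀ (chartU a b c))
include h₀ hu hv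

/-- A function on the first chart that is `u` times a function on the second chart is a
combination of `1`, `u` and `v`. -/
theorem exists_eq_linear_combination {x : ChartRing a b c} {y : ChartRing a c b}
    (h : χ₀ x = χ₀ (chartU a b c) * χ₁ y) : ∃ r s t : K,
      x = algebraMap K _ r + algebraMap K _ s * chartU a b c + algebraMap K _ t * chartV a b c := by
  obtain ⟨p, hp⟩ := exists_coeff_chartRing a b c x
  obtain ⟨q, hq⟩ := exists_coeff_chartRing a c b y
  set N := ∑ i ∈ Finset.range 4, (q i).natDegree with hN
  have hqN {i : ℕ} (hi : i < 4) : (q i).natDegree ≤ N :=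
    Finset.single_le_sum (f := fun i => (q i).natDegree) (fun _ _ => Nat.zero_le _)
      (Finset.mem_range.mpr hi)
  set u := χ₀ (chartU a b c)
  set u₁ := χ₁ (chartU a c b)
  have hrefl {i : ℕ} (hi : i < 4) : (q i).eval₂ (algebraMap K L) u₁ * u ^ N =
      ((q i).reflect N).eval₂ (algebraMap K L) u := by
    let inv : Invertible u₁ := ⟨u, hu, by rw [mul_comm, hu]⟩
    have := eval₂_reflect_mul_pow (algebraMap K L) u₁ N (q i) (hqN hi)
    rw [← this, mul_assoc, ← mul_pow, mul_comm u₁, hu, one_pow, mul_one]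
    rfl
  -- With `u₁ = 1 / u` and `v₁ = v / u`, comparing powers of `v` should give `p i = u ^ (1 - i) * (q
  -- i)(1 / u)`. The factor `u ^ (N + 3)` clears every negative exponent for `i ≤ 3`, and `reflect
  -- N` is `u ^ N * (q i)(1 / u)`.
  have key : ∑ i ∈ Finset.range 4, AdjoinRoot.of (chartPoly a b c)
      (X ^ (N + 3) * p i - (q i).reflect N * X ^ (4 - i)) * chartV a b c ^ i = 0 := by
    apply h₀
    rw [map_zero, map_sum]
    have h1 : u ^ (N + 3) * χ₀ x = u ^ (N + 3) * (u * χ₁ y) := by rw [h]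
    rw [hp, hq, map_sum, map_sum, Finset.mul_sum, Finset.mul_sum, Finset.mul_sum, ← sub_eq_zero,
      ← Finset.sum_sub_distrib] at h1
    rw [← h1]
    refine Finset.sum_congr rfl fun i hi => ?_
    have hi := Finset.mem_range.mp hi
    have hui : u ^ (4 - i) * u ^ i = u ^ 4 := by rw [← pow_add]; congr 1; omega
    simp only [map_mul, map_pow, map_sub, chartHom_of, eval₂_X]
    change (u ^ (N + 3) * _ - eval₂ _ u _ * u ^ (4 - i)) * _ = _
    rw [← hrefl hi, hv, mul_pow, sub_mul]
    linear_combination (-(eval₂ (algebraMap K L) u₁ (q i)) * u ^ N * χ₁ (chartV a c b) ^ i) * hui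
  have hcoeff {i : ℕ} (hi : i < 4) : X ^ (N + 3) * p i = (q i).reflect N * X ^ (4 - i) :=
    sub_eq_zero.mp (coeff_eq_zero_of_sum_eq_zero a b c key hi)
  -- The reflected polynomial has degree at most `N`, so `N + 3 + deg (p i) ≤ N + 4 - i`.
  have hdeg {i : ℕ} (hi : i < 4) (hpi : p i ≠ 0) : (p i).natDegree + i ≤ 1 := by
    have h1 := congr(natDegree $(hcoeff hi))
    have hr : (q i).reflect N ≠ 0 := by
      intro h0
      have := hcoeff hi
      rw [h0, zero_mul] at this
      exact hpi ((mul_eq_zero.mp this).resolve_left (pow_ne_zero _ X_ne_zero))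
    rw [natDegree_mul (pow_ne_zero _ X_ne_zero) hpi, natDegree_mul hr (pow_ne_zero _ X_ne_zero),
      natDegree_X_pow, natDegree_X_pow] at h1
    have h2 : ((q i).reflect N).natDegree ≤ max N (q i).natDegree := natDegree_reflect_le
    rw [max_eq_left (hqN hi)] at h2
    omega
  have h2 : p 2 = 0 := by
    by_contra hne
    have := hdeg (by norm_num) hne
    omega
  have h3 : p 3 = 0 := by
    by_contra hne
    have := hdeg (by norm_num) hne
    omega
  have h1 : p 1 = C ((p 1).coeff 0) := by
    by_cases hne : p 1 = 0
    · simp [hne]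
    · have := hdeg (by norm_num) hne
      exact eq_C_of_natDegree_eq_zero (by omega)
  have h0 : p 0 = C ((p 0).coeff 1) * X + C ((p 0).coeff 0) := by
    by_cases hne : p 0 = 0
    · simp [hne]
    · have := hdeg (by norm_num) hne
      exact eq_X_add_C_of_natDegree_le_one (by omega)
  refine ⟨(p 0).coeff 0, (p 0).coeff 1, (p 1).coeff 0, ?_⟩
  rw [hp, Finset.sum_range_succ, Finset.sum_range_succ, Finset.sum_range_succ,
    Finset.sum_range_one, h2, h3, h1, h0]
  simp only [map_add, map_mul, algebraMap_chartRing, chartU, coeff_add, coeff_C_mul, coeff_X,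
    coeff_C]
  simp
  ring

end Coeff

variable {α β : ChartRing a b c} {α₁ β₁ : ChartRing a c b}

/-- Differentiating `u₁ = 1 / u` and `v₁ = v / u` shows that `-u η` satisfies the formulas for `du₁`
and `dv₁` in terms of the second generator; the formula for `dv₁` also uses the equation of the
curve. -/
theorem kaehlerMap_chartForm (h2 : (2 : K) ≠ 0) (hu : χ₀ (chartU a b c) * χ₁ (chartU a c b) = 1)
    (hv : χ₀ (chartV a b c) = χ₁ (chartV a c b) * χ₀ (chartU a b c))
    (h : α * chartDu a b c + β * chartDv a b c = 1)
    (h' : α₁ * chartDu a c b + β₁ * chartDv a c b = 1) :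
    kaehlerMap χ₁ (chartForm a c b α₁ β₁) =
      -χ₀ (chartU a b c) • kaehlerMap χ₀ (chartForm a b c α β) := by
  set η := kaehlerMap χ₀ (chartForm a b c α β) with hη
  set u := χ₀ (chartU a b c) with hu'
  set v := χ₀ (chartV a b c) with hv'
  set u₁ := χ₁ (chartU a c b) with hu₁
  set v₁ := χ₁ (chartV a c b) with hv₁
  have hdu : D K L u = χ₀ (chartDv a b c) • η := by
    have := congr(kaehlerMap χ₀ $(D_chartU h2 h))
    rwa [kaehlerMap_D, kaehlerMap_smul] at this
  have hdv : D K L v = -χ₀ (chartDu a b c) • η := by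
    have := congr(kaehlerMap χ₀ $(D_chartV h2 h))
    rwa [kaehlerMap_D, kaehlerMap_smul, map_neg] at this
  have hu0 : u ≠ 0 := left_ne_zero_of_mul_eq_one hu
  have hdu₁ : D K L u₁ = -(u₁ ^ 2) • D K L u := by
    have h1 := congr(u₁ • D K L $hu)
    rw [Derivation.leibniz, Derivation.map_one_eq_zero, smul_zero, smul_add, smul_smul, smul_smul,
      mul_comm u₁, hu, one_smul] at h1
    rw [eq_neg_of_add_eq_zero_left h1]
    module
  have hv₁' : v₁ = v * u₁ := by rw [hv, mul_assoc, hu, mul_one]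
  have hdv₁ : D K L v₁ = u₁ • D K L v + v • D K L u₁ := by
    rw [hv₁', Derivation.leibniz]; module
  have hrel : affineQuartic _ _ _ u v = 0 := chartHom_relation χ₀
  have hu₁' : u₁ = u⁻¹ := eq_inv_of_mul_eq_one_right hu
  have e1 : D K L u₁ = χ₁ (chartDv a c b) • (-u • η) := by
    rw [hdu₁, hdu, smul_smul, smul_smul]
    congr 1
    simp only [chartDv, map_mul, map_add, map_pow, AlgHom.commutes, ← hu', ← hv',
      ← hu₁, ← hv₁]
    rw [hv₁', hu₁']
    field_simp
    ring
  have e2 : D K L v₁ = -χ₁ (chartDu a c b) • (-u • η) := by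
    rw [hdv₁, hdu₁, hdv, hdu, smul_smul, smul_smul, smul_smul, smul_smul, ← add_smul]
    congr 1
    simp only [chartDv, chartDu, map_mul, map_add, map_pow, AlgHom.commutes, ← hu', ← hv',
      ← hu₁, ← hv₁]
    rw [hv₁', hu₁']
    simp only [affineQuartic] at hrel
    field_simp
    linear_combination -hrel
  have : kaehlerMap χ₁ (chartForm a c b α₁ β₁) =
      (χ₁ (α₁ * chartDu a c b + β₁ * chartDv a c b)) • (-u • η) := by
    rw [chartForm, map_sub, kaehlerMap_smul, kaehlerMap_smul, kaehlerMap_D, kaehlerMap_D, ← hu₁,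
      ← hv₁, e1, e2, map_add, map_mul, map_mul]
    module
  rw [this, h', map_one, one_smul]

/-- A form regular on both charts is `x η = y η₁ = -(u y) η`, hence `x = u * (-y)` and
`exists_eq_linear_combination` applies. -/
theorem finrank_inf_range_kaehlerMap (h2 : (2 : K) ≠ 0) (ha : a ^ 2 - 1 ≠ 0) (hb : b ^ 2 - 1 ≠ 0)
    (hc : c ^ 2 - 1 ≠ 0) (hd : symmDet a b c ≠ 0) (h₀ : Function.Injective χ₀)
    (hΩ : Function.Injective (kaehlerMap χ₀)) (hu : χ₀ (chartU a b c) * χ₁ (chartU a c b) = 1)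
    (hv : χ₀ (chartV a b c) = χ₁ (chartV a c b) * χ₀ (chartU a b c)) :
    Module.finrank K ↥(LinearMap.range (kaehlerMap χ₀) ⊓ LinearMap.range (kaehlerMap χ₁)) = 3 := by
  have hd' : symmDet a c b ≠ 0 := by
    convert hd using 1
    simp only [symmDet]; ring
  have : Nontrivial (ChartRing a b c) := (isDomain_chartRing h2 ha hb hc hd).toNontrivial
  obtain ⟨α, β, h⟩ := Ideal.mem_span_pair.mp ((Ideal.eq_top_iff_one _).mp
    (span_chartDu_chartDv_eq_top (IsUnit.mk0 _ ha) (IsUnit.mk0 _ hb) (IsUnit.mk0 _ hd)))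
  obtain ⟨α₁, β₁, h'⟩ := Ideal.mem_span_pair.mp ((Ideal.eq_top_iff_one _).mp
    (span_chartDu_chartDv_eq_top (IsUnit.mk0 _ ha) (IsUnit.mk0 _ hc) (IsUnit.mk0 _ hd')))
  have hη₁ := kaehlerMap_chartForm h2 hu hv h h'
  set η := kaehlerMap χ₀ (chartForm a b c α β) with hη
  have hη0 : η ≠ 0 := fun h0 => chartForm_ne_zero h (hΩ (h0.trans (map_zero _).symm))
  set u := χ₀ (chartU a b c) with hu_def
  set v := χ₀ (chartV a b c) with hv_def
  have hsmul (r : K) (x : L) : r • (x • η) = (algebraMap K L r * x) • η := by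
    rw [mul_smul, algebraMap_smul]
  have hspan : LinearMap.range (kaehlerMap χ₀) ⊓ LinearMap.range (kaehlerMap χ₁) =
      Submodule.span K (Set.range ![(1 : L) • η, u • η, v • η]) := by
    refine le_antisymm ?_ ?_
    · rintro _ ⟨⟨ω, rfl⟩, ⟨ω₁, hω⟩⟩
      obtain ⟨x, rfl⟩ := exists_eq_smul_chartForm h2 h ω
      obtain ⟨y, rfl⟩ := exists_eq_smul_chartForm h2 h' ω₁
      rw [kaehlerMap_smul, hη₁, kaehlerMap_smul, smul_smul, ← hη] at hω
      have hxy : χ₀ x = u * χ₁ (-y) := by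
        rw [← smul_left_injective L hη0 hω, map_neg]
        ring
      obtain ⟨r, s, t, rfl⟩ := exists_eq_linear_combination h₀ hu hv hxy
      have : kaehlerMap χ₀ ((algebraMap K (ChartRing a b c) r + algebraMap K _ s * chartU a b c +
          algebraMap K _ t * chartV a b c) • chartForm a b c α β) =
          r • ((1 : L) • η) + s • (u • η) + t • (v • η) := by
        rw [kaehlerMap_smul, hsmul, hsmul, hsmul]
        simp only [map_add, map_mul, AlgHom.commutes, ← hη, ← hu_def, ← hv_def, add_smul, mul_one]
      rw [this]
      exact add_mem (add_mem
        (Submodule.smul_mem _ _ (Submodule.subset_span ⟨0, rfl⟩))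
        (Submodule.smul_mem _ _ (Submodule.subset_span ⟨1, rfl⟩)))
        (Submodule.smul_mem _ _ (Submodule.subset_span ⟨2, rfl⟩))
    · rw [Submodule.span_le]
      -- Used for `1 = u * u₁`, `u = u * 1` and `v = u * v₁`.
      have hmem (x : ChartRing a b c) (y : ChartRing a c b) (hxy : χ₀ x = u * χ₁ y) :
          χ₀ x • η ∈ LinearMap.range (kaehlerMap χ₀) ⊓ LinearMap.range (kaehlerMap χ₁) := by
        refine ⟨⟨x • chartForm a b c α β, by rw [kaehlerMap_smul]⟩,
          ⟨(-y) • chartForm a c b α₁ β₁, ?_⟩⟩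
        rw [kaehlerMap_smul, hη₁, smul_smul, hxy, map_neg]
        congr 1
        ring
      rintro _ ⟨i, rfl⟩
      fin_cases i
      · have := hmem 1 (chartU a c b) (by rw [hu, map_one])
        rwa [map_one] at this
      · exact hmem (chartU a b c) 1 (by rw [map_one, mul_one])
      · exact hmem (chartV a b c) (chartV a c b) (by rw [← hv_def, hv, mul_comm])
  have hind : LinearIndependent K ![(1 : L) • η, u • η, v • η] := by
    rw [Fintype.linearIndependent_iff]
    intro g hg
    rw [Fin.sum_univ_three] at hg
    replace hg : g 0 • ((1 : L) • η) + g 1 • (u • η) + g 2 • (v • η) = 0 := hg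
    rw [hsmul, hsmul, hsmul, ← add_smul, ← add_smul] at hg
    have hg' := (smul_eq_zero.mp hg).resolve_right hη0
    -- A linear relation among `1, u, v` is read as a polynomial in `v` over `K[u]`, whose
    -- coefficients must vanish.
    let p : ℕ → K[X] := fun i =>
      if i = 0 then C (g 0) + C (g 1) * X else if i = 1 then C (g 2) else 0
    have hp :
        ∑ i ∈ Finset.range 4, AdjoinRoot.of (chartPoly a b c) (p i) * chartV a b c ^ i = 0 := by
      apply h₀
      rw [map_zero, ← hg']
      simp only [Finset.sum_range_succ, Finset.sum_range_zero, map_add, map_mul, map_pow, p]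
      simp [chartHom_of, ← hu_def, ← hv_def]
    have h0 : C (g 0) + C (g 1) * X = 0 :=
      coeff_eq_zero_of_sum_eq_zero a b c hp (i := 0) (by norm_num)
    have h1 : C (g 2) = 0 := coeff_eq_zero_of_sum_eq_zero a b c hp (i := 1) (by norm_num)
    intro i
    fin_cases i
    · simpa using congr(coeff $h0 0)
    · simpa using congr(coeff $h0 1)
    · simpa using h1
  rw [hspan, finrank_span_eq_card hind, Fintype.card_fin]

end Regular

/-! ### Differentials and localization -/

section LocalizedDifferentials

variable {k A B : Type*} [CommRing k] [CommRing A] [CommRing B] [Algebra k A] [Algebra k B]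

/-- Differentials commute with localization, so a power of `h` clears the denominator. -/
theorem exists_kaehlerMap_eq_pow_smul (φ : A →ₐ[k] B) (h : A)
    (hφ : @IsLocalization.Away _ _ h B _ φ.toRingHom.toAlgebra) (ω : Ω[B⁄k]) :
    ∃ (n : ℕ) (η : Ω[A⁄k]), kaehlerMap φ η = φ h ^ n • ω := by
  let := φ.toRingHom.toAlgebra
  have : IsScalarTower k A B := .of_algebraMap_eq fun r => (φ.commutes r).symm
  obtain ⟨⟨η, ⟨_, n, rfl⟩⟩, hη⟩ :=
    IsLocalizedModule.surj (.powers h) (KaehlerDifferential.map k k A B) ω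
  refine ⟨n, η, hη.symm.trans ?_⟩
  exact (algebraMap_smul B (h ^ n) ω).symm.trans (by rw [map_pow]; rfl)

/-- Formal smoothness makes the differentials projective, hence torsion-free, so they embed into
their localization at the nonzero elements. -/
theorem kaehlerMap_injective_of_isFractionRing [IsDomain A] [Algebra.FormallySmooth k A]
    (φ : A →ₐ[k] B) (hφ : @IsFractionRing A _ B _ φ.toRingHom.toAlgebra) :
    Function.Injective (kaehlerMap φ) := by
  let := φ.toRingHom.toAlgebra
  have : IsScalarTower k A B := .of_algebraMap_eq fun r => (φ.commutes r).symm
  have hproj : Module.Projective A (Ω[A⁄k]) := inferInstance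
  have htf : Module.IsTorsionFree A (Ω[A⁄k]) := inferInstance
  refine (injective_iff_map_eq_zero _).mpr fun ω hω => ?_
  obtain ⟨s, hs⟩ := (IsLocalizedModule.eq_zero_iff (nonZeroDivisors A)
    (KaehlerDifferential.map k k A B)).mp hω
  exact (smul_eq_zero.mp hs).resolve_left (nonZeroDivisors.ne_zero s.2)

end LocalizedDifferentials

/-! ### The function field -/

theorem fromSpec_comp_toSpec {k : CommRingCat.{u}} {X : Scheme.{u}} (f : X ⟶ Spec k) {U : X.Opens}
    (hU : IsAffineOpen U) :
    hU.fromSpec ≫ f = Spec.map (CommRingCat.ofHom (algebraMap k (SectionRing f U))) := by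
  rw [← (isAffineOpen_top (Spec k)).SpecMap_appLE_fromSpec f hU le_top,
    IsAffineOpen.fromSpec_top, Scheme.isoSpec_Spec_inv]
  exact (Spec.map_comp _ _).symm

section FunctionField

variable {k : CommRingCat.{u}} {X : Scheme.{u}} [AlgebraicGeometry.IsIntegral X]

/-- The function field of an integral scheme `X`, to be regarded as a `k`-algebra by means of
`f : X ⟶ Spec k`. -/
def FunctionFieldOver (_f : X ⟶ Spec k) : Type u := X.functionField

instance (f : X ⟶ Spec k) : Field (FunctionFieldOver f) :=
  inferInstanceAs (Field X.functionField)

instance functionFieldOverAlgebra (f : X ⟶ Spec k) : Algebra k (FunctionFieldOver f) :=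
  ((Scheme.ΓSpecIso k).inv ≫ f.appLE ⊤ ⊤ le_top ≫
    X.presheaf.germ ⊤ (genericPoint X) trivial).hom.toAlgebra

/-- The germ of a section at the generic point. -/
def genericGerm (f : X ⟶ Spec k) (U : X.Opens) (hU : genericPoint X ∈ U) :
    SectionRing f U →ₐ[k] FunctionFieldOver f where
  __ := (X.presheaf.germ U (genericPoint X) hU).hom
  commutes' r := by
    have h : f.appLE ⊤ U le_top ≫ X.presheaf.germ U (genericPoint X) hU =
        f.appLE ⊤ ⊤ le_top ≫ X.presheaf.germ ⊤ (genericPoint X) trivial :=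
      congr($((f.appLE_map (V := ⊤) le_top (homOfLE (le_top : U ≤ ⊤)).op).symm) ≫
        X.presheaf.germ U (genericPoint X) hU).trans ((Category.assoc _ _ _).trans
        congr(f.appLE ⊤ ⊤ le_top ≫ $(X.presheaf.germ_res (homOfLE (le_top : U ≤ ⊤)) _ hU)))
    exact congr($(h).hom ((Scheme.ΓSpecIso k).inv.hom r))

variable (f : X ⟶ Spec k)

theorem genericGerm_res {U V : X.Opens} (h : V ≤ U) (hV : genericPoint X ∈ V) :
    (genericGerm f V hV).comp (SectionRing.res f h) = genericGerm f U (h hV) := by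
  ext x
  exact congr($(X.presheaf.germ_res (homOfLE h) _ hV).hom x)

theorem genericPoint_mem_of_nonempty {U : X.Opens} (hU : Nonempty U) : genericPoint X ∈ U :=
  ((genericPoint_spec X).mem_open_set_iff U.isOpen).mpr
    (by simpa using hU)

theorem kaehlerMap_genericGerm_injective [Smooth f] {U : X.Opens} (hU : IsAffineOpen U)
    (h : genericPoint X ∈ U) : Function.Injective (kaehlerMap (genericGerm f U h)) := by
  have : Nonempty U := ⟨⟨_, h⟩⟩
  have : IsDomain (SectionRing f U) := inferInstanceAs (IsDomain Γ(X, U))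
  have hs : ((Scheme.ΓSpecIso k).inv ≫ f.appLE ⊤ U le_top).hom.Smooth := by
    rw [CommRingCat.hom_comp]
    exact (RingHom.Smooth.respectsIso.cancel_left_isIso _ _).mpr
      (f.smooth_appLE (isAffineOpen_top _) hU le_top)
  have : Algebra.Smooth k (SectionRing f U) := hs
  exact kaehlerMap_injective_of_isFractionRing _
    (functionField_isFractionRing_of_isAffineOpen X U hU)

theorem SpecMap_genericGerm_fromSpec {U : X.Opens} (hU : IsAffineOpen U)
    (h : genericPoint X ∈ U) :
    Spec.map (CommRingCat.ofHom (genericGerm f U h).toRingHom) ≫ hU.fromSpec =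
      X.fromSpecStalk (genericPoint X) :=
  hU.fromSpecStalk_eq_fromSpecStalk h

end FunctionField

/-! ### Global differentials -/

section GlobalDifferentials

variable {k : CommRingCat.{u}} {X : Scheme.{u}} [AlgebraicGeometry.IsIntegral X]
  (f : X ⟶ Spec k)

/-- The generic value of a global differential is independent of the chart. -/
theorem kaehlerMap_genericGerm_eq {ω : ∀ U : X.affineOpens, Ω[SectionRing f U.1⁄k]}
    (hω : ω ∈ globalDifferentials f) (U V : X.affineOpens) (hU : genericPoint X ∈ U.1)
    (hV : genericPoint X ∈ V.1) :
    kaehlerMap (genericGerm f U.1 hU) (ω U) = kaehlerMap (genericGerm f V.1 hV) (ω V) := by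
  obtain ⟨_, ⟨W, hW, rfl⟩, hxW, hWUV⟩ := X.isBasis_affineOpens.exists_subset_of_mem_open
    (show genericPoint X ∈ U.1 ⊓ V.1 from ⟨hU, hV⟩) (U.1 ⊓ V.1).isOpen
  have h1 : W ≤ U.1 := fun x hx => (hWUV hx).1
  have h2 : W ≤ V.1 := fun x hx => (hWUV hx).2
  rw [← genericGerm_res f h1 hxW, ← genericGerm_res f h2 hxW, kaehlerMap_comp, kaehlerMap_comp,
    hω U ⟨W, hW⟩ h1, hω V ⟨W, hW⟩ h2]

theorem range_kaehlerMap_genericGerm_mono {U V : X.Opens} (h : V ≤ U) (hV : genericPoint X ∈ V) :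
    LinearMap.range (kaehlerMap (genericGerm f U (h hV))) ≤
      LinearMap.range (kaehlerMap (genericGerm f V hV)) := by
  rintro _ ⟨ω, rfl⟩
  exact ⟨kaehlerMap (SectionRing.res f h) ω, by rw [← kaehlerMap_comp, genericGerm_res]⟩

/-- Being regular is a local property of a differential of the function field. -/
theorem mem_range_kaehlerMap_genericGerm {η : Ω[FunctionFieldOver f⁄k]} {U : X.Opens}
    (hU : IsAffineOpen U) (hξ : genericPoint X ∈ U)
    (h : ∀ x ∈ U, ∃ (V : X.Opens) (hV : genericPoint X ∈ V), x ∈ V ∧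
      η ∈ LinearMap.range (kaehlerMap (genericGerm f V hV))) :
    η ∈ LinearMap.range (kaehlerMap (genericGerm f U hξ)) := by
  -- The ideal of denominators of `η` over `U`. The form is regular exactly when `1 ∈ I`, and this
  -- holds once the basic opens of elements of `I` cover `U`.
  let I : Ideal (SectionRing f U) :=
    { carrier := {s | genericGerm f U hξ s • η ∈ LinearMap.range (kaehlerMap (genericGerm f U hξ))}
      zero_mem' := ⟨0, by simp⟩
      add_mem' := fun {s t} hs ht => by
        rw [Set.mem_ofPred_eq, map_add, add_smul]
        exact add_mem hs ht
      smul_mem' := by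
        rintro s t ⟨ω, hω⟩
        exact ⟨s • ω, by rw [kaehlerMap_smul, hω, smul_eq_mul, map_mul, mul_smul]⟩ }
  suffices hI : (Ideal.span (I : Set (SectionRing f U))) = ⊤ by
    rw [Ideal.span_eq] at hI
    have : (1 : SectionRing f U) ∈ I := hI ▸ Submodule.mem_top
    simpa [I] using! this
  refine (hU.self_le_iSup_basicOpen_iff (s := (I : Set (SectionRing f U)))).mp fun x hx => ?_
  obtain ⟨V, hV, hxV, hη⟩ := h x hx
  obtain ⟨s, hsV, hxs⟩ : ∃ s : SectionRing f U, X.basicOpen (U := U) s ≤ V ∧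
      x ∈ X.basicOpen (U := U) s := hU.exists_basicOpen_le (V := V) ⟨x, hxV⟩ hx
  have hξs : genericPoint X ∈ X.basicOpen s := genericPoint_mem_of_nonempty ⟨⟨x, hxs⟩⟩
  obtain ⟨η', rfl⟩ := range_kaehlerMap_genericGerm_mono f hsV hξs hη
  obtain ⟨n, ω, hω⟩ := exists_kaehlerMap_eq_pow_smul (SectionRing.res f (X.basicOpen_le s)) s
    (hU.isLocalization_basicOpen s) η'
  -- The power `n` clears denominators; the extra factor makes the exponent positive, so that the
  -- basic open of the power is that of `s`.
  have hs : s ^ (n + 1) ∈ I := by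
    refine ⟨s • ω, ?_⟩
    rw [kaehlerMap_smul, ← genericGerm_res f (X.basicOpen_le s) hξs, kaehlerMap_comp, hω,
      kaehlerMap_smul, map_pow, map_pow, pow_succ', mul_smul]
    rfl
  refine TopologicalSpace.Opens.mem_iSup.mpr ⟨⟨_, hs⟩, ?_⟩
  exact (Scheme.basicOpen_pow (X := X) (U := U) (s : Γ(X, U)) n.succ_pos).ge hxs

variable [Smooth f]

/-- The global differentials on an integral smooth scheme covered by two affine charts are the
differentials of the function field that are regular on both. -/
theorem finrank_globalDifferentials {U V : X.affineOpens} (hU : genericPoint X ∈ U.1)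
    (hV : genericPoint X ∈ V.1) (hUV : ∀ x, x ∈ U.1 ∨ x ∈ V.1) :
    Module.finrank k (globalDifferentials f) = Module.finrank k
      ↥(LinearMap.range (kaehlerMap (genericGerm f U.1 hU)) ⊓
        LinearMap.range (kaehlerMap (genericGerm f V.1 hV))) := by
  let ev : globalDifferentials f →ₗ[k] Ω[FunctionFieldOver f⁄k] :=
    (kaehlerMap (genericGerm f U.1 hU)).comp
      ((LinearMap.proj U).comp (globalDifferentials f).subtype)
  have hev (ω : globalDifferentials f) (W : X.affineOpens) (hW : genericPoint X ∈ W.1) :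
      ev ω = kaehlerMap (genericGerm f W.1 hW) (ω.1 W) :=
    kaehlerMap_genericGerm_eq f ω.2 U W hU hW
  -- An open set that misses the generic point is empty and carries only the zero form.
  have hempty (W : X.affineOpens) (hW : genericPoint X ∉ W.1) :
      Subsingleton (Ω[SectionRing f W.1⁄k]) := by
    have : W.1 = ⊥ := by
      by_contra hne
      exact hW (genericPoint_mem_of_nonempty
        (TopologicalSpace.Opens.nonempty_coeSort.mpr
          ((TopologicalSpace.Opens.ne_bot_iff_nonempty _).mp hne)))
    have : Subsingleton (SectionRing f W.1) := by
      rw [this]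
      exact inferInstanceAs (Subsingleton Γ(X, ⊥))
    exact Module.subsingleton (SectionRing f W.1) _
  have hinj : Function.Injective ev := by
    refine (injective_iff_map_eq_zero _).mpr fun ω hω => Subtype.ext (funext fun W => ?_)
    by_cases hW : genericPoint X ∈ W.1
    · refine kaehlerMap_genericGerm_injective f W.2 hW ?_
      rw [← hev ω W hW, hω]
      exact (map_zero _).symm
    · have := hempty W hW
      exact Subsingleton.elim _ _
  have hrange : LinearMap.range ev = LinearMap.range (kaehlerMap (genericGerm f U.1 hU)) ⊓
        LinearMap.range (kaehlerMap (genericGerm f V.1 hV)) := by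
    refine le_antisymm ?_ ?_
    · rintro _ ⟨ω, rfl⟩
      exact ⟨⟨_, rfl⟩, ⟨_, (hev ω V hV).symm⟩⟩
    · rintro η ⟨hη0, hη1⟩
      have hη (W : X.affineOpens) (hW : genericPoint X ∈ W.1) :
          ∃ ω, kaehlerMap (genericGerm f W.1 hW) ω = η :=
        mem_range_kaehlerMap_genericGerm f W.2 hW fun x _ => (hUV x).elim
          (fun hx => ⟨U.1, hU, hx, hη0⟩) fun hx => ⟨V.1, hV, hx, hη1⟩
      choose ω hω using hη
      classical
      -- The value `0` is taken only on the empty open, where it is the only choice. Compatibility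
      -- elsewhere follows from injectivity into the function field.
      let ω' (W : X.affineOpens) : Ω[SectionRing f W.1⁄k] :=
        if hW : genericPoint X ∈ W.1 then ω W hW else 0
      have hω' (W : X.affineOpens) (hW : genericPoint X ∈ W.1) :
          kaehlerMap (genericGerm f W.1 hW) (ω' W) = η :=
        (congrArg _ (dif_pos hW)).trans (hω W hW)
      refine ⟨⟨ω', fun W W' h => ?_⟩, hω' U hU⟩
      by_cases hW' : genericPoint X ∈ W'.1
      · refine kaehlerMap_genericGerm_injective f W'.2 hW' ?_
        rw [← kaehlerMap_comp, genericGerm_res, hω' W', hω' W (h hW')]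
      · have := hempty W' hW'
        exact Subsingleton.elim _ _
  rw [← hrange]
  exact (LinearEquiv.ofInjective ev hinj).finrank_eq

end GlobalDifferentials

/-! ### Charts -/

section Charts

variable {k : CommRingCat.{u}} {X : Scheme.{u}} (f : X ⟶ Spec k) {A : Type u} [CommRing A]
  [Algebra k A] (j : Spec (.of A) ⟶ X) [IsOpenImmersion j]

/-- The sections of an affine chart. -/
theorem exists_algEquiv_sectionRing
    (hj : j ≫ f = Spec.map (CommRingCat.ofHom (algebraMap k A))) :
    ∃ e : A ≃ₐ[k] SectionRing f j.opensRange,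
      Spec.map (CommRingCat.ofHom e.toRingEquiv.toRingHom) ≫ j =
        (isAffineOpen_opensRange j).fromSpec := by
  have hU : IsAffineOpen j.opensRange := isAffineOpen_opensRange j
  obtain ⟨i, hi⟩ : ∃ i : Spec (.of (SectionRing f j.opensRange)) ≅ Spec (.of A),
      i.hom ≫ j = hU.fromSpec := by
    have hι : ∃ i : Spec Γ(X, j.opensRange) ≅ Spec (.of A), i.hom ≫ j = hU.fromSpec :=
      ⟨IsOpenImmersion.isoOfRangeEq hU.fromSpec j hU.range_fromSpec,
        IsOpenImmersion.isoOfRangeEq_hom_fac _ _ _⟩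
    exact hι
  obtain ⟨e, he⟩ : ∃ e : A ≃+* SectionRing f j.opensRange,
      Spec.map (CommRingCat.ofHom e.toRingHom) = i.hom := by
    let i' : CommRingCat.of A ≅ CommRingCat.of (SectionRing f j.opensRange) :=
      { hom := Spec.preimage i.hom
        inv := Spec.preimage i.inv
        hom_inv_id := Spec.map_injective (by
          rw [Spec.map_comp, Spec.map_preimage, Spec.map_preimage, i.inv_hom_id, Spec.map_id])
        inv_hom_id := Spec.map_injective (by
          rw [Spec.map_comp, Spec.map_preimage, Spec.map_preimage, i.hom_inv_id, Spec.map_id]) }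
    exact ⟨i'.commRingCatIsoToRingEquiv, Spec.map_preimage i.hom⟩
  have h : CommRingCat.ofHom (algebraMap k A) ≫ CommRingCat.ofHom e.toRingHom =
      CommRingCat.ofHom (algebraMap k (SectionRing f j.opensRange)) := Spec.map_injective (by
    rw [Spec.map_comp, he, ← hj, ← Category.assoc, hi]
    exact fromSpec_comp_toSpec f hU)
  exact ⟨AlgEquiv.ofRingEquiv (f := e) fun r => congr(($h).hom r),
    (congr($he ≫ j)).trans hi⟩

variable [AlgebraicGeometry.IsIntegral X]

/-- The map from the coordinate ring of an affine chart to the function field. -/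
theorem exists_algHom_functionFieldOver [Smooth f]
    (hj : j ≫ f = Spec.map (CommRingCat.ofHom (algebraMap k A)))
    (hξ : genericPoint X ∈ j.opensRange) :
    ∃ χ : A →ₐ[k] FunctionFieldOver f,
      Spec.map (CommRingCat.ofHom χ.toRingHom) ≫ j = X.fromSpecStalk (genericPoint X) ∧
      Function.Injective χ ∧ Function.Injective (kaehlerMap χ) ∧
      LinearMap.range (kaehlerMap χ) =
        LinearMap.range (kaehlerMap (genericGerm f j.opensRange hξ)) := by
  obtain ⟨e, he⟩ := exists_algEquiv_sectionRing f j hj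
  have hsurj := kaehlerMap_surjective e
  have hcomp (ω) : kaehlerMap ((genericGerm f j.opensRange hξ).comp e.toAlgHom) ω =
      kaehlerMap (genericGerm f j.opensRange hξ) (kaehlerMap e.toAlgHom ω) :=
    kaehlerMap_comp _ _ ω
  refine ⟨(genericGerm f _ hξ).comp e.toAlgHom, ?_, ?_, ?_, ?_⟩
  · rw [← SpecMap_genericGerm_fromSpec f (isAffineOpen_opensRange j) hξ, ← he]
    exact (congr($(Spec.map_comp _ _) ≫ j)).trans (Category.assoc _ _ _)
  · exact (germ_injective_of_isIntegral X _ hξ).comp e.injective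
  · intro ω η h
    rw [hcomp, hcomp] at h
    have h' := kaehlerMap_genericGerm_injective f (isAffineOpen_opensRange j) hξ h
    have hid (x) : kaehlerMap e.symm.toAlgHom (kaehlerMap e.toAlgHom x) = x := by
      rw [← kaehlerMap_comp]
      induction x using kaehler_induction with
      | h a b => simp
      | hadd x y hx hy => rw [map_add, hx, hy]
    rw [← hid ω, ← hid η, h']
  · ext η
    constructor
    · rintro ⟨ω, rfl⟩
      exact ⟨_, (hcomp ω).symm⟩
    · rintro ⟨ω, rfl⟩
      obtain ⟨ω, rfl⟩ := hsurj ω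
      exact ⟨ω, hcomp ω⟩

end Charts

/-! ### The genus of the quartics -/

section QuarticGenus

/-- The spectrum of the stalk at `x` consists of generizations of `x`, and these lie in every open
set containing `x`. -/
theorem exists_comp_eq_fromSpecStalk {X : Scheme.{u}} {B : Type u} [CommRing B]
    (m : Spec (.of B) ⟶ X) [IsOpenImmersion m] {x : X} (hx : x ∈ m.opensRange) :
    ∃ τ : B →+* X.presheaf.stalk x,
      Spec.map (CommRingCat.ofHom τ) ≫ m = X.fromSpecStalk x := by
  have h : Set.range (X.fromSpecStalk x) ⊆ Set.range m := by
    rw [Scheme.range_fromSpecStalk]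
    exact fun y hy => Specializes.mem_open hy m.opensRange.isOpen hx
  refine ⟨(Spec.preimage (IsOpenImmersion.lift m (X.fromSpecStalk x) h)).hom, ?_⟩
  exact (congr($(Spec.map_preimage _) ≫ m)).trans (IsOpenImmersion.lift_fac _ _ _)

theorem eq_comp_of_comp_eq {X : Scheme.{u}} {A B C : Type u} [CommRing A] [CommRing B] [CommRing C]
    {j : Spec (.of A) ⟶ X} [Mono j] {m : Spec (.of B) ⟶ X} {γ : Spec (.of C) ⟶ X} {g : A →+* B}
    {τ : B →+* C} {χ : A →+* C} (hg : Spec.map (CommRingCat.ofHom g) ≫ j = m)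
    (hτ : Spec.map (CommRingCat.ofHom τ) ≫ m = γ) (hχ : Spec.map (CommRingCat.ofHom χ) ≫ j = γ) :
    χ = τ.comp g := by
  have h : CommRingCat.ofHom χ = CommRingCat.ofHom g ≫ CommRingCat.ofHom τ := by
    refine Spec.map_injective ((cancel_mono j).mp ?_)
    rw [Spec.map_comp, Category.assoc, hg, hτ, hχ]
  exact congr(($h).hom)

variable {K : Type u} [Field K] {a b c : K} {Z : Scheme.{u}} (f : Z ⟶ Spec (.of K))

instance [AlgebraicGeometry.IsIntegral Z] : Algebra K (FunctionFieldOver f) :=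
  functionFieldOverAlgebra f

/-- A general `Z` isomorphic to the quartic is allowed, because the fibres of the family are
quartics only up to isomorphism over the field. -/
theorem curveGenus_eq_three [AlgebraicGeometry.IsIntegral Z] [Smooth f]
    (h2 : (2 : K) ≠ 0) (ha : a ^ 2 - 1 ≠ 0) (hb : b ^ 2 - 1 ≠ 0) (hc : c ^ 2 - 1 ≠ 0)
    (hd : symmDet a b c ≠ 0) (i : planeQuartic a b c ⟶ Z) [IsIso i]
    (hi : i ≫ f = planeQuarticToSpec a b c) : curveGenus f = 3 := by
  have hd' : symmDet a c b ≠ 0 := by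
    convert hd using 1
    simp only [symmDet]; ring
  have : IsDomain (ChartRing a b c) := isDomain_chartRing h2 ha hb hc hd
  have : IsDomain (ChartRing a c b) := isDomain_chartRing h2 ha hc hb hd'
  let j₀ := chartX a b c ≫ i
  let j₁ := chartY a b c ≫ i
  let m := overlapChart a b c ≫ i
  have hj₀ : j₀ ≫ f = Spec.map (CommRingCat.ofHom (algebraMap K (ChartRing a b c))) := by
    rw [Category.assoc, hi, chartX_comp_toSpec]
  have hj₁ : j₁ ≫ f = Spec.map (CommRingCat.ofHom (algebraMap K (ChartRing a c b))) := by
    rw [Category.assoc, hi, chartY_comp_toSpec]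
  have hmem (p : planeQuartic a b c) {A : Type u} [CommRing A]
      (j : Spec (.of A) ⟶ planeQuartic a b c) [IsOpenImmersion j] (hp : p ∈ j.opensRange) :
      i p ∈ (j ≫ i).opensRange := by
    obtain ⟨q, rfl⟩ := hp
    exact ⟨q, Scheme.Hom.comp_apply _ _ _⟩
  have hcover (z : Z) : z ∈ j₀.opensRange ∨ z ∈ j₁.opensRange := by
    obtain ⟨p, rfl⟩ := i.surjective z
    exact (mem_opensRange_chart a b c p).imp (hmem p _) (hmem p _)
  have hm : Nonempty m.opensRange := by
    obtain ⟨p, hp⟩ := (Set.not_disjoint_iff_nonempty_inter.mp fun h =>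
      not_disjoint_opensRange_chart a b c (TopologicalSpace.Opens.coe_disjoint.mp h))
    refine ⟨⟨i p, hmem p _ ?_⟩⟩
    rw [opensRange_overlapChart]
    exact hp
  have hξ : genericPoint Z ∈ m.opensRange := genericPoint_mem_of_nonempty hm
  have hm₀ : Spec.map (CommRingCat.ofHom (overlapX a b c)) ≫ j₀ = m := by
    rw [← Category.assoc, overlapX_comp_chartX]
  have hm₁ : Spec.map (CommRingCat.ofHom (overlapY a b c)) ≫ j₁ = m := by
    rw [← Category.assoc, overlapY_comp_chartY]
  have hξ₀ : genericPoint Z ∈ j₀.opensRange := by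
    obtain ⟨q, hq⟩ := hξ
    exact ⟨_, (Scheme.Hom.comp_apply (Spec.map (CommRingCat.ofHom (overlapX a b c)))
      j₀ q).symm.trans (congr($hm₀ q).trans hq)⟩
  have hξ₁ : genericPoint Z ∈ j₁.opensRange := by
    obtain ⟨q, hq⟩ := hξ
    exact ⟨_, (Scheme.Hom.comp_apply (Spec.map (CommRingCat.ofHom (overlapY a b c)))
      j₁ q).symm.trans (congr($hm₁ q).trans hq)⟩
  obtain ⟨χ₀, hχ₀, hinj, hΩ, hr₀⟩ := exists_algHom_functionFieldOver f j₀ hj₀ hξ₀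
  obtain ⟨χ₁, hχ₁, -, -, hr₁⟩ := exists_algHom_functionFieldOver f j₁ hj₁ hξ₁
  -- Both chart maps to the function field factor through the overlap, which carries the relations
  -- `u * u₁ = 1` and `v = v₁ * u` over to it.
  obtain ⟨τ, hτ⟩ : ∃ τ : OverlapRing a b c →+* FunctionFieldOver f,
      Spec.map (CommRingCat.ofHom τ) ≫ m = Z.fromSpecStalk (genericPoint Z) :=
    exists_comp_eq_fromSpecStalk m hξ
  have h₀ : χ₀.toRingHom = τ.comp (overlapX a b c) := eq_comp_of_comp_eq hm₀ hτ hχ₀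
  have h₁ : χ₁.toRingHom = τ.comp (overlapY a b c) := eq_comp_of_comp_eq hm₁ hτ hχ₁
  have h₀' (x) : χ₀ x = τ (overlapX a b c x) := congr($h₀ x)
  have h₁' (x) : χ₁ x = τ (overlapY a b c x) := congr($h₁ x)
  have := finrank_globalDifferentials f (U := ⟨_, isAffineOpen_opensRange j₀⟩)
    (V := ⟨_, isAffineOpen_opensRange j₁⟩) hξ₀ hξ₁ hcover
  refine this.trans ?_
  rw [← hr₀, ← hr₁]
  refine finrank_inf_range_kaehlerMap h2 ha hb hc hd hinj hΩ ?_ ?_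
  · rw [h₀', h₁', ← map_mul, overlapX_chartU_mul_overlapY_chartU, map_one]
  · rw [h₀', h₀', h₁', ← map_mul, overlapX_chartV]

end QuarticGenus

/-! ### The family of quartics -/

section Family

/-- The coefficients of a quartic all of whose fibres are nonsingular curves. -/
structure IsNonsingularTriple {T : Type*} [CommRing T] (a b c : T) : Prop where
  two : IsUnit (2 : T)
  fst : IsUnit (a ^ 2 - 1)
  snd : IsUnit (b ^ 2 - 1)
  thd : IsUnit (c ^ 2 - 1)
  det : IsUnit (symmDet a b c)

theorem isNonsingularTriple_of_isUnit {T : Type*} [CommRing T]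
    (φ : MvPolynomial (Fin 3) ℂ →+* T) (h : IsUnit (φ discriminantPoly)) :
    IsNonsingularTriple (φ (.X 0)) (φ (.X 1)) (φ (.X 2)) := by
  simp only [discriminantPoly, map_mul, IsUnit.mul_iff] at h
  obtain ⟨⟨⟨h0, h1⟩, h2⟩, h3⟩ := h
  refine ⟨?_, ?_, ?_, ?_, ?_⟩
  · have := ((IsUnit.mk0 (2 : ℂ) two_ne_zero).map MvPolynomial.C).map φ
    rwa [map_ofNat, map_ofNat] at this
  · simpa using h0
  · simpa using h1
  · simpa using h2
  · simpa [symmDet, map_ofNat] using h3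

/-- Every base change of the family to an affine scheme is a quartic with nonsingular fibres. -/
theorem exists_isPullback_curveFamily {T : Type} [CommRing T]
    (y : Spec (.of T) ⟶ parameterOpen.toScheme) :
    ∃ a b c : T, IsNonsingularTriple a b c ∧
      ∃ g, IsPullback g (planeQuarticToSpec a b c) curveFamily y := by
  obtain ⟨φ, hφ⟩ : ∃ φ : MvPolynomial (Fin 3) ℂ →+* T,
      Spec.map (CommRingCat.ofHom φ) = y ≫ parameterOpen.ι :=
    ⟨(Spec.preimage (y ≫ parameterOpen.ι)).hom, Spec.map_preimage _⟩
  -- Every point of `Spec T` lands in `U`, so no maximal ideal of `T` contains the discriminant.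
  have hunit : IsUnit (φ discriminantPoly) := by
    by_contra h
    obtain ⟨m, hm, hmem⟩ := exists_max_ideal_of_mem_nonunits h
    let p : Spec (.of T) := (⟨m, hm.isPrime⟩ : PrimeSpectrum T)
    have h1 : Spec.map (CommRingCat.ofHom φ) p ∈ parameterOpen := by
      rw [hφ, Scheme.Hom.comp_apply]
      exact (y p).2
    exact h1 hmem
  have hpull := isPullback_quarticMap φ (.X 0) (.X 1) (.X 2)
  rw [hφ] at hpull
  -- The quartic over `T` is a pullback of the total family, hence, by cancelling the square of the
  -- restriction to `U`, a pullback of `curveFamily`.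
  exact ⟨_, _, _, isNonsingularTriple_of_isUnit φ hunit, _,
    hpull.of_right' (isPullback_morphismRestrict totalFamily parameterOpen).flip⟩

theorem discriminantPoly_ne_zero : discriminantPoly ≠ 0 := fun h => by
  have := congr(MvPolynomial.eval 0 $h)
  simp [discriminantPoly] at this

theorem nonempty_parameterOpen : Nonempty parameterOpen :=
  ⟨⟨(⊥ : PrimeSpectrum (MvPolynomial (Fin 3) ℂ)), fun h => discriminantPoly_ne_zero h⟩⟩

theorem isAffineOpen_parameterOpen : IsAffineOpen parameterOpen :=
  IsAffineOpen.Spec_basicOpen _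

/-- The base `U` is affine, so up to isomorphism the family is itself a quartic over the ring of
functions on `U`. -/
theorem smooth_curveFamily : SmoothOfRelativeDimension 1 curveFamily := by
  have : IsAffine parameterOpen.toScheme := isAffineOpen_parameterOpen
  have := nonempty_parameterOpen
  obtain ⟨T, _, y, hy⟩ : ∃ (T : Type) (_ : CommRing T) (y : Spec (.of T) ⟶ parameterOpen.toScheme),
      IsIso y := ⟨Γ(parameterOpen.toScheme, ⊤), inferInstance,
        parameterOpen.toScheme.isoSpec.inv, parameterOpen.toScheme.isoSpec.isIso_inv⟩
  have : Nontrivial T := by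
    have : Nonempty (Spec (.of T)) := ⟨inv y this.some⟩
    exact PrimeSpectrum.nonempty_iff_nontrivial.mp this
  obtain ⟨a, b, c, h, g, hg⟩ := exists_isPullback_curveFamily y
  have hsm := smoothOfRelativeDimension_planeQuarticToSpec a b c h.two h.fst h.snd h.thd h.det
  have : IsIso g := hg.isIso_fst_of_isIso
  have heq : curveFamily = inv g ≫ planeQuarticToSpec a b c ≫ y := by
    rw [IsIso.eq_inv_comp, hg.w]
  -- Relative dimensions add under composition, and the two isomorphisms contribute zero.
  have hcomp : SmoothOfRelativeDimension (0 + (1 + 0))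
      (inv g ≫ planeQuarticToSpec a b c ≫ y) := inferInstance
  rw [heq]
  exact hcomp

theorem exists_isIso_planeQuartic {K : Type} [Field K] (y : Spec (.of K) ⟶ parameterOpen.toScheme)
    {Z : Scheme.{0}} {p : Z ⟶ (totalFamily ⁻¹ᵁ parameterOpen).toScheme} {q : Z ⟶ Spec (.of K)}
    (h : IsPullback p q curveFamily y) :
    ∃ a b c : K, IsNonsingularTriple a b c ∧
      ∃ i : planeQuartic a b c ⟶ Z, IsIso i ∧ i ≫ q = planeQuarticToSpec a b c := by
  obtain ⟨a, b, c, habc, g, hg⟩ := exists_isPullback_curveFamily y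
  exact ⟨a, b, c, habc, (hg.isoIsPullback _ _ h).hom, inferInstance,
    hg.isoIsPullback_hom_snd _ _ h⟩

theorem isIntegral_of_isPullback_curveFamily {K : Type} [Field K]
    (y : Spec (.of K) ⟶ parameterOpen.toScheme)
    {Z : Scheme.{0}} {p : Z ⟶ (totalFamily ⁻¹ᵁ parameterOpen).toScheme} {q : Z ⟶ Spec (.of K)}
    (h : IsPullback p q curveFamily y) : AlgebraicGeometry.IsIntegral Z := by
  obtain ⟨a, b, c, habc, i, _, -⟩ := exists_isIso_planeQuartic y h
  have := isIntegral_planeQuartic habc.two.ne_zero habc.fst.ne_zero habc.snd.ne_zero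
    habc.thd.ne_zero habc.det.ne_zero
  have : Nonempty Z := ⟨i (Classical.choice inferInstance)⟩
  exact isIntegral_of_isOpenImmersion (inv i)

theorem curveGenus_of_isPullback_curveFamily {K : Type} [Field K]
    (y : Spec (.of K) ⟶ parameterOpen.toScheme)
    {Z : Scheme.{0}} {p : Z ⟶ (totalFamily ⁻¹ᵁ parameterOpen).toScheme} {q : Z ⟶ Spec (.of K)}
    (h : IsPullback p q curveFamily y) : curveGenus q = 3 := by
  have := isIntegral_of_isPullback_curveFamily y h
  obtain ⟨a, b, c, habc, i, _, hi⟩ := exists_isIso_planeQuartic y h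
  have := smooth_curveFamily
  have : Smooth curveFamily := SmoothOfRelativeDimension.smooth 1 _
  have : Smooth q := MorphismProperty.of_isPullback h this
  exact curveGenus_eq_three q habc.two.ne_zero habc.fst.ne_zero habc.snd.ne_zero
    habc.thd.ne_zero habc.det.ne_zero i hi

theorem isSmoothProjectiveCurveFamily_curveFamily :
    IsSmoothProjectiveCurveFamily curveFamily 3 where
  smooth := smooth_curveFamily
  projective := IsProjectiveMorphism.of_isPullback
    (isPullback_morphismRestrict totalFamily parameterOpen).flip
    (isProjectiveMorphism_planeQuarticToSpec _ _ _)
  -- Geometric integrality is tested on all field-valued points of the base, each of whose pullbacks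
  -- is a nonsingular quartic.
  integral := ⟨fun _ _ y _ _ _ h => isIntegral_of_isPullback_curveFamily y h⟩
  genus s := curveGenus_of_isPullback_curveFamily (K := parameterOpen.toScheme.residueField s)
    (parameterOpen.toScheme.fromSpecResidueField s)
    (IsPullback.of_hasPullback curveFamily (parameterOpen.toScheme.fromSpecResidueField s))

/-- The fibre of the family over a point. -/
theorem exists_isPullback_totalFamily (a b c : ℂ) : ∃ g : planeQuartic a b c ⟶
    planeQuartic (.X 0 : MvPolynomial (Fin 3) ℂ) (.X 1) (.X 2),
    IsPullback g (planeQuarticToSpec a b c) totalFamily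
      (Spec.map (CommRingCat.ofHom (MvPolynomial.eval ![a, b, c]))) := by
  -- The base change has the evaluated coordinates as coefficients; naming these by variables allows
  -- them to be replaced by `a, b, c` inside the scheme.
  have H (x y z : ℂ) (hx : MvPolynomial.eval ![a, b, c] (.X 0) = x)
      (hy : MvPolynomial.eval ![a, b, c] (.X 1) = y)
      (hz : MvPolynomial.eval ![a, b, c] (.X 2) = z) : ∃ g : planeQuartic x y z ⟶
      planeQuartic (.X 0 : MvPolynomial (Fin 3) ℂ) (.X 1) (.X 2),
      IsPullback g (planeQuarticToSpec x y z) totalFamily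
      (Spec.map (CommRingCat.ofHom (MvPolynomial.eval ![a, b, c]))) := by
    subst hx hy hz
    exact ⟨_, isPullback_quarticMap _ _ _ _⟩
  exact H a b c (by simp) (by simp) (by simp)

theorem not_smooth_planeQuarticToSpec_iff (a b c : ℂ) : ¬ Smooth (planeQuarticToSpec a b c) ↔
    (a = 1 ∨ a = -1) ∨ (b = 1 ∨ b = -1) ∨ (c = 1 ∨ c = -1) ∨
      a ^ 2 + b ^ 2 + c ^ 2 - 2 * a * b * c - 1 = 0 := by
  have hsq (t : ℂ) : t = 1 ∨ t = -1 ↔ t ^ 2 - 1 = 0 := by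
    rw [sub_eq_zero, sq_eq_one_iff]
  rw [hsq, hsq, hsq]
  constructor
  · intro h
    contrapose! h
    obtain ⟨ha, hb, hc, hd⟩ := h
    have := smoothOfRelativeDimension_planeQuarticToSpec a b c (IsUnit.mk0 2 two_ne_zero)
      (IsUnit.mk0 _ ha) (IsUnit.mk0 _ hb) (IsUnit.mk0 _ hc) (IsUnit.mk0 _ hd)
    exact SmoothOfRelativeDimension.smooth 1 _
  · intro h
    refine not_smooth_planeQuarticToSpec ?_
    simp only [mul_eq_zero, symmDet, or_assoc]
    exact h

end Family
end

theorem mainTheorem6 :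
    -- `C_{abc}` is singular exactly when `(a, b, c)` lies in the stated locus
    (∀ a b c : ℂ, ¬ Smooth (planeQuarticToSpec a b c) ↔
      (a = 1 ∨ a = -1) ∨ (b = 1 ∨ b = -1) ∨ (c = 1 ∨ c = -1) ∨
        a ^ 2 + b ^ 2 + c ^ 2 - 2 * a * b * c - 1 = 0) ∧
    -- the fibre of the family over the point `(a, b, c)` is `C_{abc}`
    (∀ a b c : ℂ, ∃ g : planeQuartic a b c ⟶
        planeQuartic (.X 0 : MvPolynomial (Fin 3) ℂ) (.X 1) (.X 2),
      IsPullback g (planeQuarticToSpec a b c) totalFamily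
        (Spec.map (CommRingCat.ofHom (MvPolynomial.eval ![a, b, c])))) ∧
    -- over `U` it is a family of nonsingular projective curves of genus 3
    IsSmoothProjectiveCurveFamily curveFamily 3 :=
  ⟨not_smooth_planeQuarticToSpec_iff, exists_isPullback_totalFamily,
    isSmoothProjectiveCurveFamily_curveFamily⟩
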